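/- Let $d\ge 1$, let $\mathcal S$ be the space of rapidly decreasing smooth functions on $\mathbb R^d$ (real valued; the same is claimed for complex-valued functions) and $\mathcal S'$ its dual, the space of tempered distributions. For a multi-index $k\in\mathbb Z_+^d$ write $|k|=k_1+\dots+k_d$ and let $h_k(x)=h_{k_1}(x_1)\cdots h_{k_d}(x_d)$ be the Hermite functions, where for $\ell\ge 0$ and $s\in\mathbb R$ $$h_\ell(s)=\frac{1}{(\sqrt\pi\,2^\ell\,\ell!)^{1/2}}\,e^{-s^2/2}H_\ell(s),\qquad H_\ell(s)=(-1)^\ell e^{s^2}\frac{d^\ell}{ds^\ell}e^{-s^2}.$$ For $p\in\mathbb R$ the Hermite–Sobolev space $\mathcal S_p\subset\mathcal S'$ is the completion of $\mathcal S$ in the norm $$\|\varphi\|_p^2=\sum_{k\in\mathbb Z_+^d}(2|k|+d)^{2p}\,|\langle\varphi,h_k\rangle|^2 .$$ For $x\in\mathbb R^d$ the translation $\tau_x$ acts on functions by $\tau_xf(y)=f(y-x)$ and on $\mathcal S'$ by $\langle\tau_x\varphi,f\rangle=\langle\varphi,\tau_{-x}f\rangle$. **Theorem 2.1.** Let $p\in\mathbb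 R$. There exists a real polynomial $P_k$ of degree $k=2([\,|p|\,]+1)$, where $[\cdot]$ denotes the integer part, such that for every $x\in\mathbb R^d$ the translation $\tau_x$ maps $\mathcal S_p$ into $\mathcal S_p$, $\tau_x:\mathcal S_p\to\mathcal S_p$ is a bounded linear map, and $$\|\tau_x\varphi\|_p\le P_k(|x|)\,\|\varphi\|_p\qquad\text{for all }\varphi\in\mathcal S_p .$$ -/

import Mathlib

open scoped SchwartzMap

noncomputable section

namespace HermiteSobolev

/-! ### Hermite functions -/

/-- The physicists' Hermite polynomial (as a function), by the Rodrigues formula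
`H_l(s) = (-1)^l e^{s^2} (d/ds)^l e^{-s^2}`. -/
def hermiteH (l : ℕ) (s : ℝ) : ℝ :=
  (-1) ^ l * Real.exp (s ^ 2) * iteratedDeriv l (fun t : ℝ => Real.exp (-t ^ 2)) s

/-- The one-dimensional Hermite function
`h_l(s) = (√π 2^l l!)^{-1/2} e^{-s^2/2} H_l(s)`. -/
def hermiteFun (l : ℕ) (s : ℝ) : ℝ :=
  1 / Real.sqrt (Real.sqrt Real.pi * 2 ^ l * (Nat.factorial l : ℝ)) *
    Real.exp (-(s ^ 2 / 2)) * hermiteH l s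

/-- The Hermite function on `ℝ^d` with multi-index `k`: `h_k(x) = h_{k_1}(x_1) ⋯ h_{k_d}(x_d)`. -/
def hermiteFunMulti {d : ℕ} (k : Fin d → ℕ) (x : EuclideanSpace ℝ (Fin d)) : ℝ :=
  ∏ i, hermiteFun (k i) (x i)

/-! The Hermite functions are Schwartz functions. -/

theorem iteratedDeriv_gauss (l : ℕ) : ∃ P : Polynomial ℝ,
    iteratedDeriv l (fun t : ℝ => Real.exp (-t ^ 2)) =
      fun s => P.eval s * Real.exp (-s ^ 2) := by
  induction l with
  | zero => exact ⟨1, by ext s; simp⟩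
  | succ l ih =>
    obtain ⟨P, hP⟩ := ih
    refine ⟨P.derivative - 2 * Polynomial.X * P, ?_⟩
    ext s
    rw [iteratedDeriv_succ, hP]
    have h1 : HasDerivAt (fun s : ℝ => Real.exp (-s ^ 2))
        (Real.exp (-s ^ 2) * (-(2 * s))) s := by
      have := ((hasDerivAt_pow 2 s).neg).exp
      simpa using this
    have h2 := (P.hasDerivAt s).mul h1
    refine h2.deriv.trans ?_
    simp
    ring

theorem hermiteFun_eq (l : ℕ) : ∃ P : Polynomial ℝ,
    ∀ s, hermiteFun l s = P.eval s * Real.exp (-(s ^ 2 / 2)) := by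
  obtain ⟨P, hP⟩ := iteratedDeriv_gauss l
  refine ⟨Polynomial.C (1 / Real.sqrt (Real.sqrt Real.pi * 2 ^ l * (Nat.factorial l : ℝ)) *
    (-1) ^ l) * P, fun s => ?_⟩
  have h : Real.exp (s ^ 2) * Real.exp (-s ^ 2) = 1 := by
    rw [← Real.exp_add]; simp
  simp only [hermiteFun, hermiteH, hP, Polynomial.eval_mul, Polynomial.eval_C]
  linear_combination (1 / Real.sqrt (Real.sqrt Real.pi * 2 ^ l * (Nat.factorial l : ℝ)) *
    Real.exp (-(s ^ 2 / 2)) * (-1) ^ l * P.eval s) * h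

theorem polynomial_coord_growth {d : ℕ} (P : Polynomial ℝ) (i : Fin d) :
    Function.HasTemperateGrowth (fun x : EuclideanSpace ℝ (Fin d) => P.eval (x i)) := by
  have hx : Function.HasTemperateGrowth (fun x : EuclideanSpace ℝ (Fin d) => x i) :=
    (EuclideanSpace.proj i : EuclideanSpace ℝ (Fin d) →L[ℝ] ℝ).hasTemperateGrowth
  induction P using Polynomial.induction_on' with
  | add p q hp hq => simp only [Polynomial.eval_add]; exact hp.add hq
  | monomial n a =>
    simp only [Polynomial.eval_monomial]
    exact (Function.HasTemperateGrowth.const a).mul (hx.pow n)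

theorem prod_growth {d : ℕ} (f : Fin d → EuclideanSpace ℝ (Fin d) → ℝ)
    (hf : ∀ i, Function.HasTemperateGrowth (f i)) (s : Finset (Fin d)) :
    Function.HasTemperateGrowth (fun x => ∏ i ∈ s, f i x) := by
  classical
  induction s using Finset.induction_on with
  | empty => simp only [Finset.prod_empty]; exact Function.HasTemperateGrowth.const (1 : ℝ)
  | insert a s ha ih =>
    simp only [Finset.prod_insert ha]
    exact (hf a).mul ih

theorem pow_mul_exp_bound (m : ℕ) :
    ∃ C : ℝ, 0 ≤ C ∧ ∀ r : ℝ, 0 ≤ r → (1 + r) ^ m * Real.exp (-(r ^ 2 / 2)) ≤ C := by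
  refine ⟨(Nat.factorial m : ℝ) * Real.exp 2, by positivity, fun r hr => ?_⟩
  have h1 : (1 + r) ^ m ≤ (Nat.factorial m : ℝ) * Real.exp (1 + r) := by
    have := Real.pow_div_factorial_le_exp (1 + r) (by positivity) m
    rwa [div_le_iff₀ (by positivity), mul_comm] at this
  calc (1 + r) ^ m * Real.exp (-(r ^ 2 / 2))
      ≤ (Nat.factorial m : ℝ) * Real.exp (1 + r) * Real.exp (-(r ^ 2 / 2)) := by gcongr
    _ = (Nat.factorial m : ℝ) * Real.exp (1 + r - r ^ 2 / 2) := by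
        rw [mul_assoc, ← Real.exp_add, sub_eq_add_neg]
    _ ≤ _ := by
        gcongr
        nlinarith [sq_nonneg (r - 1)]

/-- The Gaussian `e^{-|x|^2/2}` as a Schwartz function. -/
def gaussian (d : ℕ) : 𝓢(EuclideanSpace ℝ (Fin d), ℝ) where
  toFun x := Real.exp (-(‖x‖ ^ 2 / 2))
  smooth' := by
    have : ContDiff ℝ ((⊤ : ℕ∞) : WithTop ℕ∞) (fun x : EuclideanSpace ℝ (Fin d) => ‖x‖ ^ 2) := contDiff_norm_sq ℝ
    fun_prop
  decay' := by
    intro k n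
    have hq : Function.HasTemperateGrowth
        (fun x : EuclideanSpace ℝ (Fin d) => (-(1 / 2) : ℝ) * ‖x‖ ^ 2) :=
      (Function.HasTemperateGrowth.const _).mul
        (Function.hasTemperateGrowth_norm_sq (EuclideanSpace ℝ (Fin d)))
    obtain ⟨l, C, hC, hb⟩ := hq.norm_iteratedFDeriv_le_uniform n
    obtain ⟨B, hB, hBb⟩ := pow_mul_exp_bound (k + l * n)
    refine ⟨(Nat.factorial n : ℝ) * (C + 1) ^ n * B, fun x => ?_⟩
    have hD : 1 ≤ (C + 1) * (1 + ‖x‖) ^ l := by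
      have : (1 : ℝ) ≤ (1 + ‖x‖) ^ l := one_le_pow₀ (by simp)
      nlinarith
    have key : ‖iteratedFDeriv ℝ n
        (Real.exp ∘ fun x : EuclideanSpace ℝ (Fin d) => (-(1 / 2) : ℝ) * ‖x‖ ^ 2) x‖ ≤
        (Nat.factorial n : ℝ) * Real.exp (-(‖x‖ ^ 2 / 2)) * ((C + 1) * (1 + ‖x‖) ^ l) ^ n := by
      refine norm_iteratedFDeriv_comp_le (n := n) (N := (n : WithTop ℕ∞)) Real.contDiff_exp
        (hq.1.of_le (mod_cast le_top)) le_rfl x (fun i _ => ?_) (fun i hi hin => ?_)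
      · rw [norm_iteratedFDeriv_eq_norm_iteratedDeriv, iteratedDeriv_eq_iterate,
          Real.iter_deriv_exp, Real.norm_eq_abs, Real.abs_exp]
        apply le_of_eq
        congr 1
        ring
      · calc _ ≤ C * (1 + ‖x‖) ^ l := hb i hin x
          _ ≤ (C + 1) * (1 + ‖x‖) ^ l := by gcongr; linarith
          _ ≤ _ := le_self_pow₀ hD (by omega)
    have hfun : (fun x : EuclideanSpace ℝ (Fin d) => Real.exp (-(‖x‖ ^ 2 / 2))) =
        (Real.exp ∘ fun x : EuclideanSpace ℝ (Fin d) => (-(1 / 2) : ℝ) * ‖x‖ ^ 2) := by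
      ext y
      simp only [Function.comp_apply]
      congr 1
      ring
    rw [hfun]
    calc _ ≤ (1 + ‖x‖) ^ k * ((Nat.factorial n : ℝ) * Real.exp (-(‖x‖ ^ 2 / 2)) *
          ((C + 1) * (1 + ‖x‖) ^ l) ^ n) := by
          gcongr
          linarith
      _ = (Nat.factorial n : ℝ) * (C + 1) ^ n *
          ((1 + ‖x‖) ^ (k + l * n) * Real.exp (-(‖x‖ ^ 2 / 2))) := by
          rw [mul_pow, pow_add, pow_mul]; ring
      _ ≤ _ := by
          gcongr
          exact hBb _ (norm_nonneg _)

theorem exists_hermiteSchwartz {d : ℕ} (k : Fin d → ℕ) :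
    ∃ f : 𝓢(EuclideanSpace ℝ (Fin d), ℝ), ∀ x, f x = hermiteFunMulti k x := by
  choose P hP using hermiteFun_eq
  refine ⟨SchwartzMap.smulLeftCLM ℝ (fun x : EuclideanSpace ℝ (Fin d) =>
    ∏ i, (P (k i)).eval (x i)) (gaussian d), fun x => ?_⟩
  rw [SchwartzMap.smulLeftCLM_apply_apply
    (prod_growth _ (fun i => polynomial_coord_growth (P (k i)) i) Finset.univ)]
  change (∏ i, (P (k i)).eval (x i)) * Real.exp (-(‖x‖ ^ 2 / 2)) = _
  simp only [hermiteFunMulti, hP, Finset.prod_mul_distrib]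
  rw [← Real.exp_sum, EuclideanSpace.norm_sq_eq]
  simp [Finset.sum_div]

/-- The Hermite function `h_k` as an element of the Schwartz space of real- or complex-valued
functions. -/
def hermite (𝕜 : Type*) [RCLike 𝕜] {d : ℕ} (k : Fin d → ℕ) :
    𝓢(EuclideanSpace ℝ (Fin d), 𝕜) where
  toFun x := (hermiteFunMulti k x : 𝕜)
  smooth' := by
    obtain ⟨f, hf⟩ := exists_hermiteSchwartz k
    have h := (SchwartzMap.postcompCLM (RCLike.ofRealCLM : ℝ →L[ℝ] 𝕜) f).smooth'
    convert h using 2 with x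
    change _ = (SchwartzMap.postcompCLM (RCLike.ofRealCLM : ℝ →L[ℝ] 𝕜) f) x
    simp [← hf x]
  decay' := by
    obtain ⟨f, hf⟩ := exists_hermiteSchwartz k
    have h := (SchwartzMap.postcompCLM (RCLike.ofRealCLM : ℝ →L[ℝ] 𝕜) f).decay'
    have e : (fun x => (hermiteFunMulti k x : 𝕜)) =
        (SchwartzMap.postcompCLM (RCLike.ofRealCLM : ℝ →L[ℝ] 𝕜) f).toFun := by
      ext x
      change _ = (SchwartzMap.postcompCLM (RCLike.ofRealCLM : ℝ →L[ℝ] 𝕜) f) x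
      simp [← hf x]
    rw [e]
    exact h

/-! ### Tempered distributions and translations -/

/-- The space `S'` of tempered distributions on `ℝ^d`, i.e. the dual of the space `S` of `𝕜`-valued
Schwartz functions (`𝕜 = ℝ` or `ℂ`). -/
abbrev TempDist (𝕜 : Type*) [RCLike 𝕜] (d : ℕ) : Type _ :=
  𝓢(EuclideanSpace ℝ (Fin d), 𝕜) →L[𝕜] 𝕜

/-- Translation of distributions: `⟨τ_x φ, f⟩ = ⟨φ, τ_{-x} f⟩`, where `τ_x f (y) = f (y - x)`. -/
def translate {𝕜 : Type*} [RCLike 𝕜] {d : ℕ} (x : EuclideanSpace ℝ (Fin d))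
    (φ : TempDist 𝕜 d) : TempDist 𝕜 d :=
  φ.comp (SchwartzMap.compSubConstCLM 𝕜 (-x))

/-- The subspace `S` of `S'`: the distributions `g ↦ ∫ f g` with `f` a Schwartz function. -/
def schwartzSubmodule (𝕜 : Type*) [RCLike 𝕜] (d : ℕ) : Submodule 𝕜 (TempDist 𝕜 d) where
  carrier := {φ | ∃ f : 𝓢(EuclideanSpace ℝ (Fin d), 𝕜),
    ∀ g : 𝓢(EuclideanSpace ℝ (Fin d), 𝕜), φ g = ∫ x, f x * g x}
  zero_mem' := ⟨0, fun g => by simp⟩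
  add_mem' := by
    rintro φ ψ ⟨f, hf⟩ ⟨f', hf'⟩
    refine ⟨f + f', fun g => ?_⟩
    have hi : ∀ f : 𝓢(EuclideanSpace ℝ (Fin d), 𝕜),
        MeasureTheory.Integrable (fun x => f x * g x) := fun f => by
      have := (SchwartzMap.pairing (ContinuousLinearMap.mul 𝕜 𝕜) f g).integrable
        (μ := MeasureTheory.volume)
      exact this.congr (Filter.Eventually.of_forall fun x => by simp)
    simp only [add_apply, hf, hf']
    rw [← MeasureTheory.integral_add (hi f) (hi f')]
    simp [add_mul]
  smul_mem' := by
    rintro c φ ⟨f, hf⟩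
    refine ⟨c • f, fun g => ?_⟩
    simp [hf, mul_assoc, MeasureTheory.integral_const_mul]

/-! ### The Hermite–Sobolev spaces -/

/-- The weighted Hermite coefficients `(2|k|+d)^p ⟨φ, h_k⟩` of a tempered distribution. -/
def weightedCoeff {𝕜 : Type*} [RCLike 𝕜] {d : ℕ} (p : ℝ) (φ : TempDist 𝕜 d)
    (k : Fin d → ℕ) : 𝕜 :=
  (((2 * (∑ i, (k i : ℝ)) + d) ^ p : ℝ) : 𝕜) * φ (hermite 𝕜 k)

theorem weightedCoeff_add {𝕜 : Type*} [RCLike 𝕜] {d : ℕ} (p : ℝ) (φ ψ : TempDist 𝕜 d) :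
    weightedCoeff p (φ + ψ) = weightedCoeff p φ + weightedCoeff p ψ := by
  ext k; simp [weightedCoeff, mul_add]

theorem weightedCoeff_smul {𝕜 : Type*} [RCLike 𝕜] {d : ℕ} (p : ℝ) (c : 𝕜) (φ : TempDist 𝕜 d) :
    weightedCoeff p (c • φ) = c • weightedCoeff p φ := by
  ext k; simp [weightedCoeff, mul_left_comm]

theorem weightedCoeff_zero {𝕜 : Type*} [RCLike 𝕜] {d : ℕ} (p : ℝ) :
    weightedCoeff p (0 : TempDist 𝕜 d) = 0 := by
  ext k; simp [weightedCoeff]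

/-- The tempered distributions with `∑_k (2|k|+d)^{2p} |⟨φ, h_k⟩|^2 < ∞`. -/
def finiteNorm (𝕜 : Type*) [RCLike 𝕜] (d : ℕ) (p : ℝ) : Submodule 𝕜 (TempDist 𝕜 d) where
  carrier := {φ | Memℓp (weightedCoeff p φ) 2}
  zero_mem' := by
    change Memℓp (weightedCoeff p (0 : TempDist 𝕜 d)) 2
    rw [weightedCoeff_zero]
    exact zero_memℓp
  add_mem' := by
    intro φ ψ hφ hψ
    change Memℓp (weightedCoeff p (φ + ψ)) 2
    rw [weightedCoeff_add]
    exact Memℓp.add hφ hψ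
  smul_mem' := by
    intro c φ hφ
    change Memℓp (weightedCoeff p (c • φ)) 2
    rw [weightedCoeff_smul]
    exact Memℓp.const_smul hφ c

/-- The space `finiteNorm 𝕜 d p`, to be equipped with the norm `‖·‖_p` (and not with the topology
that it inherits from the space of distributions). -/
def FiniteNorm (𝕜 : Type*) [RCLike 𝕜] (d : ℕ) (p : ℝ) : Type _ := ↥(finiteNorm 𝕜 d p)

instance instAddCommGroupFiniteNorm (𝕜 : Type*) [RCLike 𝕜] (d : ℕ) (p : ℝ) :
    AddCommGroup (FiniteNorm 𝕜 d p) :=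
  inferInstanceAs (AddCommGroup ↥(finiteNorm 𝕜 d p))

instance instModuleFiniteNorm (𝕜 : Type*) [RCLike 𝕜] (d : ℕ) (p : ℝ) :
    Module 𝕜 (FiniteNorm 𝕜 d p) :=
  inferInstanceAs (Module 𝕜 ↥(finiteNorm 𝕜 d p))

/-- The inclusion into the space of tempered distributions. -/
def FiniteNorm.toTempDist {𝕜 : Type*} [RCLike 𝕜] {d : ℕ} {p : ℝ} :
    FiniteNorm 𝕜 d p →ₗ[𝕜] TempDist 𝕜 d :=
  (finiteNorm 𝕜 d p).subtype

/-- The family of weighted Hermite coefficients as an element of the Hilbert space `ℓ²`. -/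
def FiniteNorm.toL2 {𝕜 : Type*} [RCLike 𝕜] {d : ℕ} {p : ℝ} :
    FiniteNorm 𝕜 d p →ₗ[𝕜] lp (fun _ : Fin d → ℕ => 𝕜) 2 where
  toFun φ := ⟨weightedCoeff p φ.toTempDist, φ.2⟩
  map_add' φ ψ := by
    apply Subtype.ext
    exact weightedCoeff_add p φ.toTempDist ψ.toTempDist
  map_smul' c φ := by
    apply Subtype.ext
    exact weightedCoeff_smul p c φ.toTempDist

/-- The norm `‖φ‖_p = (∑_k (2|k|+d)^{2p} |⟨φ, h_k⟩|^2)^{1/2}`. -/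
instance instSeminormedFiniteNorm (𝕜 : Type*) [RCLike 𝕜] (d : ℕ) (p : ℝ) :
    SeminormedAddCommGroup (FiniteNorm 𝕜 d p) :=
  SeminormedAddCommGroup.induced _ _ (FiniteNorm.toL2 (𝕜 := 𝕜) (d := d) (p := p))

instance instNormedSpaceFiniteNorm (𝕜 : Type*) [RCLike 𝕜] (d : ℕ) (p : ℝ) :
    NormedSpace 𝕜 (FiniteNorm 𝕜 d p) :=
  NormedSpace.induced 𝕜 _ _ (FiniteNorm.toL2 (𝕜 := 𝕜) (d := d) (p := p))

theorem FiniteNorm.norm_sq {𝕜 : Type*} [RCLike 𝕜] {d : ℕ} {p : ℝ} (φ : FiniteNorm 𝕜 d p) :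
    ‖φ‖ ^ 2 = ∑' k : Fin d → ℕ, (2 * (∑ i, (k i : ℝ)) + d) ^ (2 * p) *
      ‖φ.toTempDist (hermite 𝕜 k)‖ ^ 2 := by
  have h : ‖φ‖ = ‖FiniteNorm.toL2 φ‖ := rfl
  rw [h]
  have h2 := lp.norm_rpow_eq_tsum (p := 2) (by norm_num) (FiniteNorm.toL2 φ)
  norm_num at h2
  rw [h2]
  refine tsum_congr fun k => ?_
  have hk : (FiniteNorm.toL2 φ : (Fin d → ℕ) → 𝕜) k = weightedCoeff p φ.toTempDist k := rfl
  have hn : 0 ≤ 2 * (∑ i, (k i : ℝ)) + d := by positivity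
  rw [hk, weightedCoeff, norm_mul, mul_pow, RCLike.norm_ofReal, sq_abs, mul_comm 2 p,
    Real.rpow_mul hn, Real.rpow_two]

/-- The Hermite–Sobolev space `S_p`: the completion of `S` in the norm `‖·‖_p`, realised as a space
of tempered distributions, namely as the `‖·‖_p`-closure of `S` in the space of all tempered
distributions for which `‖·‖_p` is finite. It carries the norm `‖·‖_p`. -/
def Space (𝕜 : Type*) [RCLike 𝕜] (d : ℕ) (p : ℝ) : Submodule 𝕜 (FiniteNorm 𝕜 d p) :=
  ((schwartzSubmodule 𝕜 d).comap FiniteNorm.toTempDist).topologicalClosure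

/-- The inclusion `S_p ⊂ S'`. -/
def Space.toTempDist {𝕜 : Type*} [RCLike 𝕜] {d : ℕ} {p : ℝ} : Space 𝕜 d p →ₗ[𝕜] TempDist 𝕜 d :=
  FiniteNorm.toTempDist ∘ₗ (Space 𝕜 d p).subtype

end HermiteSobolev

end

/-!
The Hermite functions satisfy `∂_j h_k = √(k_j/2) h_{k-e_j} - √((k_j+1)/2) h_{k+e_j}`. Hence, for a
tempered distribution `φ`, the Hermite coefficients `u_k(t)` of `τ_{tx} φ` solve the infinite linear
system `u' = A u`, where `A = ladderOp x` is antisymmetric and couples only neighbouring indices,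
with coefficients of size at most `‖x‖ s_k`, where `s_k = √(2|k|+d)`. The norm `‖τ_{tx} φ‖_p` is the
`ℓ²`-norm of `u(t)` with the weights `s_k^{4p}`.

For any weights `w_k(t)`, antisymmetry turns `d/dt ∑ w_k |u_k|²` into `∑ w_k' |u_k|²` plus a sum over
edges `(k, k + e_j)` which contains only the differences `w_{k+e_j} - w_k`. As `s_{k+e_j} - s_k` is of
order `1/s_k`, translating by `x` moves the variable `s` by at most a multiple `b` of `‖x‖`. Weights
that move against this drift with speed `b`, namely `(s_k + b(1-t))^{4p}` for `p ≥ 0` and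
`(s_k + bt)^{4p}` for `p ≤ 0`, decrease fast enough in time to absorb the edge terms, and the energy is
nonincreasing (`tsum_weight_le`, `tsum_moving_weight_le`). Comparing the times `0` and `1` gives
`‖τ_x φ‖_p² ≤ (1+b)^{4|p|} ‖φ‖_p²` for every real `p` at once, with no interpolation or duality
(`sum_weight_le`).

All sums converge because the weights carry an additional factor `e^{-ε(s_k + bt)}`, which varies as
slowly as needed and is removed at the end by `ε → 0`, whereas `u_k(t)` grows at most polynomially in
`k` (`norm_translate_hermite_le`). The latter holds because `φ` is bounded by finitely many Schwartz
seminorms and those of `h_k` grow polynomially (`seminorm_hermite_le`). The estimate applies to all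
distributions with finite norm `‖·‖_p`; since `τ_x` preserves the Schwartz functions, by continuity it
also preserves their closure.
-/

namespace HermiteSobolev

open MeasureTheory Set Filter Topology LineDeriv

/-! ### One-dimensional Hermite functions -/

/-- The coefficient `√(n/2)` of the ladder relations
`h_n' = √(n/2) h_{n-1} - √((n+1)/2) h_{n+1}` and `s h_n = √(n/2) h_{n-1} + √((n+1)/2) h_{n+1}`. -/
noncomputable def ladderCoeff (n : ℕ) : ℝ := Real.sqrt (n / 2)

theorem ladderCoeff_nonneg (n : ℕ) : 0 ≤ ladderCoeff n := Real.sqrt_nonneg _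

@[simp] theorem ladderCoeff_zero : ladderCoeff 0 = 0 := by simp [ladderCoeff]

theorem ladderCoeff_sq (n : ℕ) : ladderCoeff n ^ 2 = n / 2 := Real.sq_sqrt (by positivity)

theorem hasDerivAt_iteratedDeriv_gauss (l : ℕ) (s : ℝ) :
    HasDerivAt (iteratedDeriv l (fun t : ℝ => Real.exp (-t ^ 2)))
      (iteratedDeriv (l + 1) (fun t : ℝ => Real.exp (-t ^ 2)) s) s := by
  have h : DifferentiableAt ℝ (iteratedDeriv l (fun t : ℝ => Real.exp (-t ^ 2))) s := by
    obtain ⟨P, hP⟩ := iteratedDeriv_gauss l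
    rw [hP]
    fun_prop
  rw [iteratedDeriv_succ]
  exact h.hasDerivAt

theorem iteratedDeriv_gauss_succ (l : ℕ) (s : ℝ) :
    iteratedDeriv (l + 1) (fun t : ℝ => Real.exp (-t ^ 2)) s =
      -2 * s * iteratedDeriv l (fun t : ℝ => Real.exp (-t ^ 2)) s -
        2 * l * iteratedDeriv (l - 1) (fun t : ℝ => Real.exp (-t ^ 2)) s := by
  induction l generalizing s with
  | zero =>
    have h1 : HasDerivAt (fun s : ℝ => Real.exp (-s ^ 2)) (Real.exp (-s ^ 2) * (-(2 * s))) s := by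
      simpa using ((hasDerivAt_pow 2 s).neg).exp
    simp only [zero_add, iteratedDeriv_one, iteratedDeriv_zero, h1.deriv]
    push_cast
    ring
  | succ l ih =>
    have h := hasDerivAt_iteratedDeriv_gauss (l + 1) s
    rw [show iteratedDeriv (l + 1) (fun t : ℝ => Real.exp (-t ^ 2)) = _ from funext ih] at h
    refine h.unique ?_
    have h2 : HasDerivAt (fun s => 2 * (l : ℝ) *
        iteratedDeriv (l - 1) (fun t : ℝ => Real.exp (-t ^ 2)) s)
        (2 * (l : ℝ) * iteratedDeriv l (fun t : ℝ => Real.exp (-t ^ 2)) s) s := by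
      rcases l with _ | l
      · simpa using hasDerivAt_const s (0 : ℝ)
      · exact (hasDerivAt_iteratedDeriv_gauss l s).const_mul _
    have h3 := (((hasDerivAt_id s).const_mul (-2)).mul
      (hasDerivAt_iteratedDeriv_gauss l s)).sub h2
    refine h3.congr_deriv ?_
    simp only [id, Nat.add_sub_cancel]
    push_cast
    ring

theorem hermiteNorm_succ (l : ℕ) :
    1 / Real.sqrt (Real.sqrt Real.pi * 2 ^ l * (Nat.factorial l : ℝ)) =
      2 * ladderCoeff (l + 1) *
        (1 / Real.sqrt (Real.sqrt Real.pi * 2 ^ (l + 1) * (Nat.factorial (l + 1) : ℝ))) := by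
  have h1 : Real.sqrt Real.pi * 2 ^ (l + 1) * (Nat.factorial (l + 1) : ℝ) =
      (Real.sqrt Real.pi * 2 ^ l * (Nat.factorial l : ℝ)) * (2 ^ 2 * (((l + 1 : ℕ) : ℝ) / 2)) := by
    rw [Nat.factorial_succ]
    push_cast
    ring
  have h2 : Real.sqrt (2 ^ 2 * (((l + 1 : ℕ) : ℝ) / 2)) = 2 * ladderCoeff (l + 1) := by
    rw [Real.sqrt_mul (by positivity), Real.sqrt_sq (by norm_num), ladderCoeff]
  have h3 : 0 < ladderCoeff (l + 1) := Real.sqrt_pos.2 (by positivity)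
  have h4 : 0 < Real.sqrt (Real.sqrt Real.pi * 2 ^ l * (Nat.factorial l : ℝ)) :=
    Real.sqrt_pos.2 (by positivity)
  rw [h1, Real.sqrt_mul (x := Real.sqrt Real.pi * 2 ^ l * (Nat.factorial l : ℝ)) (by positivity),
    h2]
  field_simp

theorem ladder_mul_hermiteFun_succ (l : ℕ) (s : ℝ) :
    2 * ladderCoeff (l + 1) * hermiteFun (l + 1) s =
      -(1 / Real.sqrt (Real.sqrt Real.pi * 2 ^ l * (Nat.factorial l : ℝ)) *
        Real.exp (-(s ^ 2 / 2)) * ((-1) ^ l * Real.exp (s ^ 2) *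
          iteratedDeriv (l + 1) (fun t : ℝ => Real.exp (-t ^ 2)) s)) := by
  rw [hermiteNorm_succ, hermiteFun, hermiteH]
  ring

theorem mul_hermiteFun (l : ℕ) (s : ℝ) :
    s * hermiteFun l s =
      ladderCoeff l * hermiteFun (l - 1) s + ladderCoeff (l + 1) * hermiteFun (l + 1) s := by
  have h1 := ladder_mul_hermiteFun_succ l s
  rw [iteratedDeriv_gauss_succ] at h1
  rcases l with _ | l
  · simp only [hermiteFun, hermiteH, ladderCoeff_zero] at h1 ⊢
    push_cast at h1
    linear_combination (-1 / 2) * h1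
  · have h2 := ladderCoeff_sq (l + 1)
    have h3 := hermiteNorm_succ l
    simp only [Nat.add_sub_cancel] at h1 ⊢
    push_cast at h2 h1
    have h4 : ladderCoeff (l + 1) * hermiteFun l s =
        1 / Real.sqrt (Real.sqrt Real.pi * 2 ^ (l + 1) * (Nat.factorial (l + 1) : ℝ)) *
        Real.exp (-(s ^ 2 / 2)) * ((-1) ^ l * Real.exp (s ^ 2) * (((l : ℝ) + 1) *
          iteratedDeriv l (fun t : ℝ => Real.exp (-t ^ 2)) s)) := by
      rw [hermiteFun, hermiteH, h3]
      linear_combination (2 * (1 / Real.sqrt (Real.sqrt Real.pi * 2 ^ (l + 1) *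
        (Nat.factorial (l + 1) : ℝ))) *
        Real.exp (-(s ^ 2 / 2)) * ((-1) ^ l * Real.exp (s ^ 2) *
          iteratedDeriv l (fun t : ℝ => Real.exp (-t ^ 2)) s)) * h2
    rw [h4, hermiteFun, hermiteH]
    linear_combination (-1 / 2) * h1

theorem hasDerivAt_hermiteFun (l : ℕ) (s : ℝ) :
    HasDerivAt (hermiteFun l)
      (ladderCoeff l * hermiteFun (l - 1) s - ladderCoeff (l + 1) * hermiteFun (l + 1) s) s := by
  have h1 := ladder_mul_hermiteFun_succ l s
  have h2 := mul_hermiteFun l s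
  have e1 : HasDerivAt (fun s : ℝ => Real.exp (-(s ^ 2 / 2)))
      (Real.exp (-(s ^ 2 / 2)) * (-s)) s := by
    refine (((hasDerivAt_pow 2 s).div_const 2).neg.exp).congr_deriv ?_
    simp
  have e2 : HasDerivAt (fun s : ℝ => Real.exp (s ^ 2)) (Real.exp (s ^ 2) * (2 * s)) s := by
    refine ((hasDerivAt_pow 2 s).exp).congr_deriv ?_
    simp
  have h3 := (e1.const_mul
    (1 / Real.sqrt (Real.sqrt Real.pi * 2 ^ l * (Nat.factorial l : ℝ)))).mul
    ((e2.const_mul ((-1) ^ l)).mul (hasDerivAt_iteratedDeriv_gauss l s))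
  refine h3.congr_deriv ?_
  simp only [hermiteFun, hermiteH, Pi.mul_apply] at h1 h2 ⊢
  linear_combination h1 + h2

theorem integrable_hermiteFun_mul (l m : ℕ) :
    Integrable (fun s => hermiteFun l s * hermiteFun m s) := by
  obtain ⟨P, hP⟩ := hermiteFun_eq l
  obtain ⟨Q, hQ⟩ := hermiteFun_eq m
  have h : (fun s => hermiteFun l s * hermiteFun m s) =
      fun s => (P * Q).eval s * Real.exp (-1 * s ^ 2) := by
    ext s
    rw [hP, hQ, Polynomial.eval_mul, show -1 * s ^ 2 = -(s ^ 2 / 2) + -(s ^ 2 / 2) by ring,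
      Real.exp_add]
    ring
  rw [h]
  generalize P * Q = R
  induction R using Polynomial.induction_on' with
  | add p q hp hq =>
    simp only [Polynomial.eval_add, add_mul]
    exact hp.add hq
  | monomial n a =>
    have := (integrable_rpow_mul_exp_neg_mul_sq (b := 1) one_pos (s := n)
      (by have : (0 : ℝ) ≤ n := by positivity
          linarith)).const_mul a
    simpa [Polynomial.eval_monomial, mul_assoc] using this

/-- With `2 √((l+1)/2) h_{l+1} = s h_l - h_l'` and `2 √((l+1)/2) h_l = s h_{l+1} + h_{l+1}'`, the
difference of the two integrals is the integral of the derivative of `-h_l h_{l+1}`. -/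
theorem integral_hermiteFun_sq_succ (l : ℕ) :
    ∫ s, hermiteFun (l + 1) s ^ 2 = ∫ s, hermiteFun l s ^ 2 := by
  have hpos : 0 < ladderCoeff (l + 1) := Real.sqrt_pos.2 (by positivity)
  have hi : ∀ m, Integrable (fun s => hermiteFun m s ^ 2) := fun m => by
    simpa only [sq] using integrable_hermiteFun_mul m m
  have hd : ∀ s, HasDerivAt (fun s => hermiteFun l s * hermiteFun (l + 1) s)
      (2 * ladderCoeff (l + 1) * (hermiteFun l s ^ 2 - hermiteFun (l + 1) s ^ 2)) s := fun s => by
    have h1 := mul_hermiteFun l s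
    have h2 := mul_hermiteFun (l + 1) s
    refine ((hasDerivAt_hermiteFun l s).mul (hasDerivAt_hermiteFun (l + 1) s)).congr_deriv ?_
    simp only [Nat.add_sub_cancel] at h2 ⊢
    linear_combination hermiteFun l s * h2 - hermiteFun (l + 1) s * h1
  have h := integral_eq_zero_of_hasDerivAt_of_integrable hd
    (((hi l).sub (hi (l + 1))).const_mul _) (integrable_hermiteFun_mul l (l + 1))
  rw [integral_const_mul, integral_sub (hi l) (hi (l + 1))] at h
  have := (mul_eq_zero.1 h).resolve_left (by positivity)
  linarith

theorem integral_hermiteFun_sq (l : ℕ) :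
    ∫ s, hermiteFun l s ^ 2 = ∫ s, hermiteFun 0 s ^ 2 := by
  induction l with
  | zero => rfl
  | succ l ih => rw [integral_hermiteFun_sq_succ, ih]

/-- `h_l(s)^2` is the integral of `2 h_l h_l'` over `(-∞, s]`, and all `h_l` have the same
`L²`-norm. -/
theorem hermiteFun_sq_le (l : ℕ) (s : ℝ) :
    hermiteFun l s ^ 2 ≤ 2 * (l + 1) * ∫ s, hermiteFun 0 s ^ 2 := by
  have hi : ∀ m, Integrable (fun s => hermiteFun m s ^ 2) := fun m => by
    simpa only [sq] using integrable_hermiteFun_mul m m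
  set f' : ℝ → ℝ := fun s => 2 * hermiteFun l s *
    (ladderCoeff l * hermiteFun (l - 1) s - ladderCoeff (l + 1) * hermiteFun (l + 1) s) with hf'
  have hd : ∀ s, HasDerivAt (fun s => hermiteFun l s ^ 2) (f' s) s := fun s => by
    refine ((hasDerivAt_hermiteFun l s).pow 2).congr_deriv ?_
    simp [hf']
  have hint : Integrable f' := by
    have := ((integrable_hermiteFun_mul l (l - 1)).const_mul (2 * ladderCoeff l)).sub
      ((integrable_hermiteFun_mul l (l + 1)).const_mul (2 * ladderCoeff (l + 1)))
    refine this.congr (Eventually.of_forall fun s => ?_)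
    simp only [hf', Pi.sub_apply]
    ring
  have hbot := tendsto_zero_of_hasDerivAt_of_integrableOn_Iic (a := s) (fun x _ => hd x)
    hint.integrableOn (hi l).integrableOn
  have hint1 : Integrable (fun s => l * hermiteFun (l - 1) s ^ 2 +
      (l + 1) * hermiteFun (l + 1) s ^ 2) :=
    ((hi (l - 1)).const_mul _).add ((hi (l + 1)).const_mul _)
  have hint2 : Integrable (fun s => hermiteFun l s ^ 2 +
      (l * hermiteFun (l - 1) s ^ 2 + (l + 1) * hermiteFun (l + 1) s ^ 2)) := (hi l).add hint1
  have hle : ∀ s, |f' s| ≤ hermiteFun l s ^ 2 +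
      (l * hermiteFun (l - 1) s ^ 2 + (l + 1) * hermiteFun (l + 1) s ^ 2) := fun s => by
    have h1 := ladderCoeff_sq l
    have h2 := ladderCoeff_sq (l + 1)
    push_cast at h2
    set a := ladderCoeff l * hermiteFun (l - 1) s
    set b := ladderCoeff (l + 1) * hermiteFun (l + 1) s
    have ha : a ^ 2 = l / 2 * hermiteFun (l - 1) s ^ 2 := by rw [mul_pow, h1]
    have hb : b ^ 2 = (l + 1) / 2 * hermiteFun (l + 1) s ^ 2 := by rw [mul_pow, h2]
    rw [abs_le]
    constructor <;> simp only [hf'] <;>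
      nlinarith [sq_nonneg (hermiteFun l s - (a - b)), sq_nonneg (hermiteFun l s + (a - b)),
        sq_nonneg (a + b)]
  calc hermiteFun l s ^ 2 = ∫ t in Iic s, f' t := by
        rw [integral_Iic_of_hasDerivAt_of_tendsto' (fun x _ => hd x) hint.integrableOn hbot, sub_zero]
    _ ≤ ∫ t in Iic s, |f' t| := setIntegral_mono hint.integrableOn hint.abs.integrableOn
        fun t => le_abs_self _
    _ ≤ ∫ t, |f' t| := setIntegral_le_integral hint.abs (Eventually.of_forall fun t => abs_nonneg _)
    _ ≤ ∫ t, (hermiteFun l t ^ 2 +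
          (l * hermiteFun (l - 1) t ^ 2 + (l + 1) * hermiteFun (l + 1) t ^ 2)) :=
        integral_mono hint.abs hint2 hle
    _ = _ := by
        rw [integral_add (hi l) hint1,
          integral_add ((hi (l - 1)).const_mul _) ((hi (l + 1)).const_mul _),
          integral_const_mul, integral_const_mul, integral_hermiteFun_sq l,
          integral_hermiteFun_sq (l - 1), integral_hermiteFun_sq (l + 1)]
        ring

section Schwartz

variable {𝕜 : Type*} [RCLike 𝕜] {d : ℕ}

/-! ### Schwartz seminorms, partial derivatives and translations -/

/-- The Schwartz seminorms of order `n + 1` are controlled by those of order `n` of the partial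
derivatives. -/
theorem seminorm_succ_le (m n : ℕ) (f : 𝓢(EuclideanSpace ℝ (Fin d), 𝕜)) :
    SchwartzMap.seminorm 𝕜 m (n + 1) f ≤
      ∑ j : Fin d, SchwartzMap.seminorm 𝕜 m n (∂_{EuclideanSpace.single j (1 : ℝ)} f) := by
  refine SchwartzMap.seminorm_le_bound 𝕜 m (n + 1) f
    (Finset.sum_nonneg fun (j : Fin d) _ => apply_nonneg _ _) fun y => ?_
  let L : Fin d → 𝕜 →L[ℝ] (EuclideanSpace ℝ (Fin d) →L[ℝ] 𝕜) := fun j =>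
    ContinuousLinearMap.smulRightL ℝ (EuclideanSpace ℝ (Fin d)) 𝕜 (EuclideanSpace.proj j)
  have hL : ∀ j, ‖L j‖ ≤ 1 := fun j => by
    refine ContinuousLinearMap.opNorm_le_bound _ zero_le_one fun c => ?_
    refine ContinuousLinearMap.opNorm_le_bound _ (by positivity) fun v => ?_
    simp only [L, ContinuousLinearMap.smulRightL_apply_apply, ContinuousLinearMap.smulRight_apply,
      PiLp.proj_apply, norm_smul, one_mul]
    rw [mul_comm]
    gcongr
    exact PiLp.norm_apply_le v j
  have hf : fderiv ℝ f = fun y => ∑ j, L j ((∂_{EuclideanSpace.single j (1 : ℝ)} f) y) := by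
    ext y v
    have hv : v = ∑ j, v j • EuclideanSpace.single j (1 : ℝ) := by
      ext i
      simp [Pi.single_apply]
    simp only [_root_.sum_apply, L,
      ContinuousLinearMap.smulRightL_apply_apply, ContinuousLinearMap.smulRight_apply,
      PiLp.proj_apply, SchwartzMap.lineDerivOp_apply_eq_fderiv]
    conv_lhs => rw [hv]
    simp [map_sum, map_smul]
  have hc : ∀ j, ContDiff ℝ n (fun y => L j ((∂_{EuclideanSpace.single j (1 : ℝ)} f) y)) :=
    fun j => (L j).contDiff.comp (SchwartzMap.smooth _ n)
  have hn : ‖iteratedFDeriv ℝ (n + 1) f y‖ ≤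
      ∑ j : Fin d, ‖iteratedFDeriv ℝ n
        (∂_{EuclideanSpace.single j (1 : ℝ)} f : 𝓢(EuclideanSpace ℝ (Fin d), 𝕜)) y‖ := by
    rw [← norm_iteratedFDeriv_fderiv, hf,
      iteratedFDeriv_fun_sum_apply (fun j _ => (hc j).contDiffAt)]
    refine (norm_sum_le _ _).trans (Finset.sum_le_sum fun j _ => ?_)
    refine ((L j).norm_iteratedFDeriv_comp_left
      (SchwartzMap.contDiffAt (∂_{EuclideanSpace.single j (1 : ℝ)} f) n) le_rfl).trans ?_
    exact mul_le_of_le_one_left (norm_nonneg _) (hL j)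
  refine (mul_le_mul_of_nonneg_left hn (by positivity)).trans ?_
  rw [Finset.mul_sum]
  exact Finset.sum_le_sum fun j _ => SchwartzMap.le_seminorm 𝕜 m n _ y

theorem lineDeriv_compSubConst (a v : EuclideanSpace ℝ (Fin d))
    (f : 𝓢(EuclideanSpace ℝ (Fin d), 𝕜)) :
    ∂_{v} (SchwartzMap.compSubConstCLM 𝕜 a f) = SchwartzMap.compSubConstCLM 𝕜 a (∂_{v} f) := by
  ext y
  simp only [SchwartzMap.lineDerivOp_apply_eq_fderiv, SchwartzMap.compSubConstCLM_apply]
  have : (SchwartzMap.compSubConstCLM 𝕜 a f : EuclideanSpace ℝ (Fin d) → 𝕜) =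
      fun y => f (y - a) := rfl
  rw [this, fderiv_comp_sub]

theorem lineDeriv_comm (v w : EuclideanSpace ℝ (Fin d))
    (f : 𝓢(EuclideanSpace ℝ (Fin d), 𝕜)) : ∂_{v} (∂_{w} f) = ∂_{w} (∂_{v} f) := by
  ext y
  have hd : DifferentiableAt ℝ (fderiv ℝ f) y :=
    (SchwartzMap.fderivCLM 𝕜 (EuclideanSpace ℝ (Fin d)) 𝕜 f).differentiableAt
  have h : ∀ v w : EuclideanSpace ℝ (Fin d),
      (∂_{v} (∂_{w} f)) y = fderiv ℝ (fderiv ℝ f) y v w := fun v w => by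
    rw [SchwartzMap.lineDerivOp_apply_eq_fderiv]
    change fderiv ℝ (fun y => fderiv ℝ f y w) y v = _
    rw [fderiv_clm_apply hd (by fun_prop)]
    simp
  rw [h, h]
  exact (f.contDiffAt 2).isSymmSndFDerivAt (by simp) v w

theorem norm_pow_le_of_add (m : ℕ) (y v : EuclideanSpace ℝ (Fin d)) :
    ‖y‖ ^ m ≤ 2 ^ m * (‖y + v‖ ^ m + ‖v‖ ^ m) := by
  have h1 : ‖y‖ ≤ ‖y + v‖ + ‖v‖ := by
    simpa using norm_sub_le (y + v) v
  have h2 := add_pow_le (norm_nonneg (y + v)) (norm_nonneg v) m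
  calc ‖y‖ ^ m ≤ (‖y + v‖ + ‖v‖) ^ m := by gcongr
    _ ≤ 2 ^ (m - 1) * (‖y + v‖ ^ m + ‖v‖ ^ m) := h2
    _ ≤ _ := by
        gcongr
        · norm_num
        · omega

theorem seminorm_compSubConst_le (m n : ℕ) (v : EuclideanSpace ℝ (Fin d))
    (f : 𝓢(EuclideanSpace ℝ (Fin d), 𝕜)) :
    SchwartzMap.seminorm 𝕜 m n (SchwartzMap.compSubConstCLM 𝕜 (-v) f) ≤
      2 ^ m * (SchwartzMap.seminorm 𝕜 m n f + ‖v‖ ^ m * SchwartzMap.seminorm 𝕜 0 n f) := by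
  have h0 : ∀ m n, 0 ≤ SchwartzMap.seminorm 𝕜 m n f := fun m n => apply_nonneg _ _
  refine SchwartzMap.seminorm_le_bound 𝕜 m n _
    (mul_nonneg (by positivity) (add_nonneg (h0 _ _) (mul_nonneg (by positivity) (h0 _ _))))
    fun y => ?_
  have e : (SchwartzMap.compSubConstCLM 𝕜 (-v) f : EuclideanSpace ℝ (Fin d) → 𝕜) =
      fun y => f (y + v) := by
    ext y
    simp
  rw [e, iteratedFDeriv_comp_add_right]
  calc ‖y‖ ^ m * ‖iteratedFDeriv ℝ n f (y + v)‖
      ≤ 2 ^ m * (‖y + v‖ ^ m + ‖v‖ ^ m) * ‖iteratedFDeriv ℝ n f (y + v)‖ := by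
        gcongr
        exact norm_pow_le_of_add m y v
    _ = 2 ^ m * (‖y + v‖ ^ m * ‖iteratedFDeriv ℝ n f (y + v)‖ +
          ‖v‖ ^ m * (‖y + v‖ ^ 0 * ‖iteratedFDeriv ℝ n f (y + v)‖)) := by ring
    _ ≤ _ := by
        gcongr
        · exact SchwartzMap.le_seminorm 𝕜 m n f _
        · exact SchwartzMap.le_seminorm 𝕜 0 n f _

theorem hasDerivAt_comp_line (f : 𝓢(EuclideanSpace ℝ (Fin d), 𝕜))
    (x y : EuclideanSpace ℝ (Fin d)) (s : ℝ) :
    HasDerivAt (fun s : ℝ => f (y + s • x)) ((∂_{x} f) (y + s • x)) s := by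
  have h1 : HasDerivAt (fun s : ℝ => y + s • x) x s := by
    simpa using ((hasDerivAt_id s).smul_const x).const_add y
  exact (f.hasFDerivAt (y + s • x)).comp_hasDerivAt s h1

/-- First-order Taylor expansion of `h ↦ f(· + hx)`, in the seminorms without derivatives. -/
theorem seminorm_zero_taylor (m : ℕ) (x : EuclideanSpace ℝ (Fin d))
    (f : 𝓢(EuclideanSpace ℝ (Fin d), 𝕜)) :
    ∃ C, ∀ h : ℝ, |h| ≤ 1 →
      SchwartzMap.seminorm 𝕜 m 0
        (SchwartzMap.compSubConstCLM 𝕜 (-(h • x)) f - f - (h : 𝕜) • ∂_{x} f) ≤ C * h ^ 2 := by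
  set g : 𝓢(EuclideanSpace ℝ (Fin d), 𝕜) := ∂_{x} (∂_{x} f) with hg
  set B := 2 ^ m * (SchwartzMap.seminorm 𝕜 m 0 g + ‖x‖ ^ m * SchwartzMap.seminorm 𝕜 0 0 g)
    with hB
  have hB0 : 0 ≤ B := by
    have h0 : ∀ m n, 0 ≤ SchwartzMap.seminorm 𝕜 m n g := fun m n => apply_nonneg _ _
    exact mul_nonneg (by positivity) (add_nonneg (h0 _ _) (mul_nonneg (by positivity) (h0 _ _)))
  have hBg : ∀ (y : EuclideanSpace ℝ (Fin d)) (s : ℝ), |s| ≤ 1 →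
      ‖y‖ ^ m * ‖g (y + s • x)‖ ≤ B := fun y s hs => by
    have h1 := (SchwartzMap.compSubConstCLM 𝕜 (-(s • x)) g).norm_pow_mul_le_seminorm 𝕜 m y
    rw [SchwartzMap.compSubConstCLM_apply, sub_neg_eq_add] at h1
    refine h1.trans ((seminorm_compSubConst_le m 0 (s • x) g).trans ?_)
    have : ‖s • x‖ ≤ ‖x‖ := by
      rw [norm_smul]
      exact mul_le_of_le_one_left (norm_nonneg _) hs
    rw [hB]
    gcongr
  refine ⟨B, fun h hh => SchwartzMap.seminorm_le_bound 𝕜 m 0 _ (by positivity) fun y => ?_⟩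
  rw [norm_iteratedFDeriv_zero]
  have e : (SchwartzMap.compSubConstCLM 𝕜 (-(h • x)) f - f - (h : 𝕜) • ∂_{x} f) y =
      (f (y + h • x) - h • (∂_{x} f) y) - (f (y + (0 : ℝ) • x) - (0 : ℝ) • (∂_{x} f) y) := by
    simp [RCLike.real_smul_eq_coe_mul]
    ring
  have hlt : ∀ s ∈ uIcc 0 h, |s| ≤ |h| := fun s hs => by
    have := abs_sub_left_of_mem_uIcc hs
    simpa using this
  rw [e]
  rcases (pow_nonneg (norm_nonneg y) m).eq_or_lt' with hpos | hpos
  · rw [hpos, zero_mul]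
    positivity
  · have h1 : ∀ s ∈ uIcc 0 h, ‖(∂_{x} f) (y + s • x) - (∂_{x} f) y‖ ≤ B / ‖y‖ ^ m * |h| :=
      fun s hs => by
        have := Convex.norm_image_sub_le_of_norm_hasDerivWithin_le
          (f := fun s : ℝ => (∂_{x} f) (y + s • x)) (f' := fun s => g (y + s • x))
          (s := uIcc 0 h) (x := 0) (y := s) (C := B / ‖y‖ ^ m)
          (fun r _ => (hasDerivAt_comp_line (∂_{x} f) x y r).hasDerivWithinAt)
          (fun r hr => by
            rw [le_div_iff₀' hpos]
            exact hBg y r ((hlt r hr).trans hh)) (convex_uIcc _ _) left_mem_uIcc hs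
        simp only [zero_smul, add_zero, sub_zero, Real.norm_eq_abs] at this
        refine this.trans ?_
        exact mul_le_mul_of_nonneg_left (hlt s hs) (by positivity)
    have h2 := Convex.norm_image_sub_le_of_norm_hasDerivWithin_le
      (f := fun s : ℝ => f (y + s • x) - s • (∂_{x} f) y)
      (f' := fun s => (∂_{x} f) (y + s • x) - (∂_{x} f) y)
      (s := uIcc 0 h) (x := 0) (y := h) (C := B / ‖y‖ ^ m * |h|)
      (fun r _ => ((hasDerivAt_comp_line f x y r).sub
        (by simpa using (hasDerivAt_id r).smul_const ((∂_{x} f) y))).hasDerivWithinAt)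
      h1 (convex_uIcc _ _) left_mem_uIcc right_mem_uIcc
    calc _ ≤ ‖y‖ ^ m * (B / ‖y‖ ^ m * |h| * ‖h - 0‖) := by gcongr
      _ = B * h ^ 2 := by
        rw [sub_zero, Real.norm_eq_abs, ← sq_abs h]
        field_simp

theorem seminorm_taylor (m n : ℕ) (x : EuclideanSpace ℝ (Fin d))
    (f : 𝓢(EuclideanSpace ℝ (Fin d), 𝕜)) :
    ∃ C, ∀ h : ℝ, |h| ≤ 1 →
      SchwartzMap.seminorm 𝕜 m n
        (SchwartzMap.compSubConstCLM 𝕜 (-(h • x)) f - f - (h : 𝕜) • ∂_{x} f) ≤ C * h ^ 2 := by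
  induction n generalizing f with
  | zero => exact seminorm_zero_taylor m x f
  | succ n ih =>
    choose C hC using fun j : Fin d => ih (∂_{EuclideanSpace.single j (1 : ℝ)} f)
    refine ⟨∑ j, C j, fun h hh => (seminorm_succ_le m n _).trans ?_⟩
    rw [Finset.sum_mul]
    refine Finset.sum_le_sum fun j _ => (le_of_eq ?_).trans (hC j h hh)
    simp only [sub_eq_add_neg, lineDerivOp_add, lineDerivOp_neg, lineDerivOp_smul]
    rw [lineDeriv_compSubConst, lineDeriv_comm _ x]

theorem exists_seminorm_bound (φ : TempDist 𝕜 d) :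
    ∃ (s : Finset (ℕ × ℕ)) (C : ℝ), 0 ≤ C ∧ ∀ f : 𝓢(EuclideanSpace ℝ (Fin d), 𝕜),
      ‖φ f‖ ≤ C * ∑ i ∈ s, SchwartzMap.seminorm 𝕜 i.1 i.2 f := by
  obtain ⟨s, C, -, h⟩ := Seminorm.bound_of_continuous
    (schwartz_withSeminorms 𝕜 (EuclideanSpace ℝ (Fin d)) 𝕜)
    ((normSeminorm 𝕜 𝕜).comp φ.toLinearMap) (continuous_norm.comp φ.continuous)
  refine ⟨s, C, C.2, fun f => (h f).trans ?_⟩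
  refine mul_le_mul_of_nonneg_left ?_ C.2
  refine (Seminorm.finset_sup_le_sum _ s f).trans (le_of_eq ?_)
  have hs : ∀ t : Finset (ℕ × ℕ), (∑ i ∈ t, schwartzSeminormFamily 𝕜
      (EuclideanSpace ℝ (Fin d)) 𝕜 i) f = ∑ i ∈ t, SchwartzMap.seminorm 𝕜 i.1 i.2 f := by
    intro t
    induction t using Finset.induction_on with
    | empty => simp
    | insert a t ha ih => rw [Finset.sum_insert ha, Finset.sum_insert ha, ← ih]; rfl
  exact hs s

/-- Testing a tempered distribution against the translates `f(· + tx)` is differentiable in `t`. -/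
theorem hasDerivAt_translate (φ : TempDist 𝕜 d) (x : EuclideanSpace ℝ (Fin d))
    (f : 𝓢(EuclideanSpace ℝ (Fin d), 𝕜)) (t : ℝ) :
    HasDerivAt (fun t : ℝ => translate (t • x) φ f) (translate (t • x) φ (∂_{x} f)) t := by
  obtain ⟨s, C, hC, hφ⟩ := exists_seminorm_bound φ
  set g := SchwartzMap.compSubConstCLM 𝕜 (-(t • x)) f with hg
  choose B hB using fun i : ℕ × ℕ => seminorm_taylor i.1 i.2 x g
  rw [hasDerivAt_iff_isLittleO_nhds_zero]
  refine Asymptotics.IsBigO.trans_isLittleO (g := fun h : ℝ => h ^ 2) ?_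
    (Asymptotics.isLittleO_pow_id one_lt_two)
  refine Asymptotics.IsBigO.of_bound (C * ∑ i ∈ s, B i) ?_
  filter_upwards [Metric.ball_mem_nhds (0 : ℝ) one_pos] with h hh
  have hh' : |h| ≤ 1 := by
    rw [Metric.mem_ball, dist_zero_right, Real.norm_eq_abs] at hh
    exact hh.le
  have e : translate ((t + h) • x) φ f - translate (t • x) φ f -
      h • translate (t • x) φ (∂_{x} f) =
      φ (SchwartzMap.compSubConstCLM 𝕜 (-(h • x)) g - g - (h : 𝕜) • ∂_{x} g) := by
    have e1 : SchwartzMap.compSubConstCLM 𝕜 (-(h • x)) g =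
        SchwartzMap.compSubConstCLM 𝕜 (-((t + h) • x)) f := by
      rw [hg, SchwartzMap.compSubConstCLM_comp, add_smul, neg_add]
    rw [map_sub, map_sub, map_smul, e1, hg, lineDeriv_compSubConst, RCLike.real_smul_eq_coe_mul]
    rfl
  rw [e, Real.norm_eq_abs, abs_of_nonneg (sq_nonneg h), mul_assoc, Finset.sum_mul]
  refine (hφ _).trans ?_
  gcongr with i
  exact hB i h hh'

/-! ### Hermite functions of several variables -/

theorem hermiteFunMulti_eq_mul {k k' : Fin d → ℕ} {j : Fin d} (h : ∀ i ≠ j, k' i = k i)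
    {x x' : EuclideanSpace ℝ (Fin d)} (hx : ∀ i ≠ j, x' i = x i) :
    hermiteFunMulti k' x' =
      hermiteFun (k' j) (x' j) * ∏ i ∈ Finset.univ.erase j, hermiteFun (k i) (x i) := by
  rw [hermiteFunMulti, ← Finset.mul_prod_erase _ _ (Finset.mem_univ j)]
  congr 1
  refine Finset.prod_congr rfl fun i hi => ?_
  rw [h i (Finset.ne_of_mem_erase hi), hx i (Finset.ne_of_mem_erase hi)]

theorem coord_mul_hermiteFunMulti (k : Fin d → ℕ) (j : Fin d) (x : EuclideanSpace ℝ (Fin d)) :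
    x j * hermiteFunMulti k x =
      ladderCoeff (k j) * hermiteFunMulti (k - Pi.single j 1) x +
        ladderCoeff (k j + 1) * hermiteFunMulti (k + Pi.single j 1) x := by
  rw [hermiteFunMulti_eq_mul (k := k) (j := j) (fun _ _ => rfl) (fun _ _ => rfl),
    hermiteFunMulti_eq_mul (k' := k - Pi.single j 1) (k := k) (j := j) (fun i hi => by simp [hi])
      (fun _ _ => rfl),
    hermiteFunMulti_eq_mul (k' := k + Pi.single j 1) (k := k) (j := j) (fun i hi => by simp [hi])
      (fun _ _ => rfl)]
  have := mul_hermiteFun (k j) (x j)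
  simp only [Pi.sub_apply, Pi.add_apply, Pi.single_eq_same]
  linear_combination (∏ i ∈ Finset.univ.erase j, hermiteFun (k i) (x i)) * this

@[simp] theorem hermite_apply (k : Fin d → ℕ) (x : EuclideanSpace ℝ (Fin d)) :
    hermite 𝕜 k x = (hermiteFunMulti k x : 𝕜) := rfl

theorem lineDeriv_hermite (k : Fin d → ℕ) (j : Fin d) :
    ∂_{EuclideanSpace.single j (1 : ℝ)} (hermite 𝕜 k) =
      (ladderCoeff (k j) : 𝕜) • hermite 𝕜 (k - Pi.single j 1) -
        (ladderCoeff (k j + 1) : 𝕜) • hermite 𝕜 (k + Pi.single j 1) := by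
  ext x
  have h1 : HasDerivAt (fun t : ℝ => hermiteFunMulti k (x + t • EuclideanSpace.single j (1 : ℝ)))
      (ladderCoeff (k j) * hermiteFunMulti (k - Pi.single j 1) x -
        ladderCoeff (k j + 1) * hermiteFunMulti (k + Pi.single j 1) x) 0 := by
    have e : (fun t : ℝ => hermiteFunMulti k (x + t • EuclideanSpace.single j (1 : ℝ))) =
        fun t => hermiteFun (k j) (x j + t) *
          ∏ i ∈ Finset.univ.erase j, hermiteFun (k i) (x i) := by
      ext t
      rw [hermiteFunMulti_eq_mul (k := k) (j := j) (x := x) (fun _ _ => rfl)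
        (fun i hi => by simp [hi])]
      simp
    rw [e]
    have h2 : HasDerivAt (fun t : ℝ => hermiteFun (k j) (x j + t)) _ 0 :=
      HasDerivAt.comp_const_add (x j) 0 (hasDerivAt_hermiteFun (k j) (x j + 0))
    refine (h2.mul_const _).congr_deriv ?_
    rw [hermiteFunMulti_eq_mul (k' := k - Pi.single j 1) (k := k) (j := j)
        (fun i hi => by simp [hi]) (fun _ _ => rfl),
      hermiteFunMulti_eq_mul (k' := k + Pi.single j 1) (k := k) (j := j)
        (fun i hi => by simp [hi]) (fun _ _ => rfl)]
    simp only [Pi.sub_apply, Pi.add_apply, Pi.single_eq_same, add_zero]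
    ring
  have h3 := hasDerivAt_comp_line (hermite 𝕜 k) (EuclideanSpace.single j (1 : ℝ)) x 0
  rw [zero_smul, add_zero] at h3
  have h4 : HasDerivAt (fun t : ℝ =>
      hermite 𝕜 k (x + t • EuclideanSpace.single j (1 : ℝ)))
      (((ladderCoeff (k j) * hermiteFunMulti (k - Pi.single j 1) x -
        ladderCoeff (k j + 1) * hermiteFunMulti (k + Pi.single j 1) x : ℝ)) : 𝕜) 0 :=
    (RCLike.ofRealCLM (K := 𝕜)).hasFDerivAt.comp_hasDerivAt 0 h1
  rw [h3.unique h4]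
  simp

theorem lineDeriv_eq_sum (x : EuclideanSpace ℝ (Fin d)) (f : 𝓢(EuclideanSpace ℝ (Fin d), 𝕜)) :
    ∂_{x} f = ∑ j, (x j : 𝕜) • ∂_{EuclideanSpace.single j (1 : ℝ)} f := by
  have hx : x = ∑ j, x j • EuclideanSpace.single j (1 : ℝ) := by
    ext i
    simp [Pi.single_apply]
  conv_lhs => rw [hx]
  rw [lineDerivOp_left_sum]
  refine Finset.sum_congr rfl fun j _ => ?_
  rw [lineDerivOp_left_smul]
  ext y
  simp [RCLike.real_smul_eq_coe_mul]

/-- The eigenvalue `2|k| + d` of the harmonic oscillator at `h_k`. -/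
noncomputable def level (k : Fin d → ℕ) : ℝ := 2 * (∑ i, (k i : ℝ)) + d

theorem one_le_level (hd : 0 < d) (k : Fin d → ℕ) : 1 ≤ level k := by
  have h1 : (1 : ℝ) ≤ d := by exact_mod_cast hd
  have h2 : 0 ≤ ∑ i, (k i : ℝ) := Finset.sum_nonneg fun _ _ => by positivity
  unfold level
  linarith

theorem level_add_single (k : Fin d → ℕ) (j : Fin d) :
    level (k + Pi.single j 1) = level k + 2 := by
  simp only [level, Pi.add_apply, Nat.cast_add, Finset.sum_add_distrib]
  simp [Pi.single_apply]
  ring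

theorem level_sub_single_le (k : Fin d → ℕ) (j : Fin d) :
    level (k - Pi.single j 1) ≤ level k := by
  unfold level
  gcongr
  simp

theorem coord_le_level (k : Fin d → ℕ) (j : Fin d) : 2 * (k j : ℝ) + 1 ≤ level k := by
  have h1 : (k j : ℝ) ≤ ∑ i, (k i : ℝ) :=
    Finset.single_le_sum (f := fun i => (k i : ℝ)) (fun _ _ => by positivity) (Finset.mem_univ j)
  have h2 : (1 : ℝ) ≤ d := by exact_mod_cast j.pos
  unfold level
  linarith

theorem ladderCoeff_le_level (k : Fin d → ℕ) (j : Fin d) :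
    ladderCoeff (k j) ≤ level k ∧ ladderCoeff (k j + 1) ≤ level k := by
  have h1 := coord_le_level k j
  have h0 : (0 : ℝ) ≤ k j := by positivity
  constructor
  · refine abs_le_of_sq_le_sq' ?_ (by linarith) |>.2
    rw [ladderCoeff_sq]
    nlinarith
  · refine abs_le_of_sq_le_sq' ?_ (by linarith) |>.2
    rw [ladderCoeff_sq]
    push_cast
    nlinarith

theorem abs_hermiteFunMulti_le :
    ∃ C M, 0 ≤ C ∧ ∀ (k : Fin d → ℕ) (x : EuclideanSpace ℝ (Fin d)),
      |hermiteFunMulti k x| ≤ C * level k ^ (M : ℕ) := by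
  set I := ∫ s, hermiteFun 0 s ^ 2 with hI
  have hI0 : 0 ≤ I := integral_nonneg fun s => sq_nonneg _
  refine ⟨(I + 1) ^ d, 2 * d, by positivity, fun k x => ?_⟩
  have h1 : ∀ i, |hermiteFun (k i) (x i)| ≤ (I + 1) * level k ^ 2 := fun i => by
    have h2 := hermiteFun_sq_le (k i) (x i)
    have h3 := coord_le_level k i
    have h0 : (0 : ℝ) ≤ k i := by positivity
    have h4 : 1 ≤ level k := by linarith
    have h5 : 1 ≤ level k ^ 2 := by nlinarith
    refine abs_le_of_sq_le_sq ?_ (by positivity)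
    calc _ ≤ 2 * (k i + 1) * I := h2
      _ ≤ (2 * level k) * I := by gcongr; linarith
      _ ≤ (I + 1) ^ 2 * level k ^ 2 := by
          have : level k ≤ level k ^ 2 := by nlinarith
          nlinarith [mul_nonneg hI0 (sub_nonneg.2 this), mul_nonneg hI0 hI0]
      _ ≤ (I + 1) ^ 2 * (level k ^ 2) ^ 2 := by
          gcongr
          nlinarith
      _ = _ := by ring
  calc |hermiteFunMulti k x| = ∏ i, |hermiteFun (k i) (x i)| := by
        rw [hermiteFunMulti, Finset.abs_prod]
    _ ≤ ∏ i : Fin d, (I + 1) * level k ^ 2 :=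
        Finset.prod_le_prod (fun i _ => abs_nonneg _) fun i _ => h1 i
    _ = _ := by
        rw [Finset.prod_const, Finset.card_univ, Fintype.card_fin, mul_pow, ← pow_mul]

theorem level_pow_shift_le (k : Fin d → ℕ) (j : Fin d) (M : ℕ) :
    level (k - Pi.single j 1) ^ M ≤ 3 ^ M * level k ^ M ∧
      level (k + Pi.single j 1) ^ M ≤ 3 ^ M * level k ^ M := by
  have h1 := one_le_level j.pos k
  have h2 := one_le_level j.pos (k - Pi.single j 1)
  have h3 := level_sub_single_le k j
  rw [level_add_single, ← mul_pow]
  constructor <;> gcongr <;> linarith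

theorem norm_pow_mul_hermiteFunMulti_le (m : ℕ) :
    ∃ C M, 0 ≤ C ∧ ∀ (k : Fin d → ℕ) (x : EuclideanSpace ℝ (Fin d)),
      ‖x‖ ^ m * |hermiteFunMulti k x| ≤ C * level k ^ (M : ℕ) := by
  induction m with
  | zero => simpa using abs_hermiteFunMulti_le
  | succ m ih =>
    obtain ⟨C, M, hC, h⟩ := ih
    refine ⟨d * (2 * (C * 3 ^ M)), M + 1, by positivity, fun k x => ?_⟩
    have hx : ‖x‖ ≤ ∑ j, |x j| := by
      have h1 : x = ∑ j, x j • EuclideanSpace.single j (1 : ℝ) := by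
        ext i
        simp [Pi.single_apply]
      calc ‖x‖ = ‖∑ j, x j • EuclideanSpace.single j (1 : ℝ)‖ := by rw [← h1]
        _ ≤ ∑ j, ‖x j • EuclideanSpace.single j (1 : ℝ)‖ := norm_sum_le _ _
        _ = ∑ j, |x j| := by simp [norm_smul]
    have hj : ∀ j, ‖x‖ ^ m * (|x j| * |hermiteFunMulti k x|) ≤
        2 * (C * 3 ^ M) * level k ^ (M + 1) := fun j => by
      obtain ⟨a1, a2⟩ := ladderCoeff_le_level k j
      obtain ⟨b1, b2⟩ := level_pow_shift_le k j M
      have h1 := one_le_level j.pos k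
      rw [← abs_mul, coord_mul_hermiteFunMulti]
      calc _ ≤ ‖x‖ ^ m * (level k * |hermiteFunMulti (k - Pi.single j 1) x| +
            level k * |hermiteFunMulti (k + Pi.single j 1) x|) := by
            gcongr
            refine (abs_add_le _ _).trans ?_
            rw [abs_mul, abs_mul, abs_of_nonneg (ladderCoeff_nonneg _),
              abs_of_nonneg (ladderCoeff_nonneg _)]
            gcongr
        _ = level k * (‖x‖ ^ m * |hermiteFunMulti (k - Pi.single j 1) x|) +
            level k * (‖x‖ ^ m * |hermiteFunMulti (k + Pi.single j 1) x|) := by ring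
        _ ≤ level k * (C * (3 ^ M * level k ^ M)) + level k * (C * (3 ^ M * level k ^ M)) := by
            have c1 := (h (k - Pi.single j 1) x).trans (mul_le_mul_of_nonneg_left b1 hC)
            have c2 := (h (k + Pi.single j 1) x).trans (mul_le_mul_of_nonneg_left b2 hC)
            have h0 : 0 ≤ level k := by linarith
            exact add_le_add (mul_le_mul_of_nonneg_left c1 h0) (mul_le_mul_of_nonneg_left c2 h0)
        _ = _ := by ring
    calc ‖x‖ ^ (m + 1) * |hermiteFunMulti k x|
        = ‖x‖ ^ m * (‖x‖ * |hermiteFunMulti k x|) := by ring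
      _ ≤ ‖x‖ ^ m * ((∑ j, |x j|) * |hermiteFunMulti k x|) := by gcongr
      _ = ∑ j, ‖x‖ ^ m * (|x j| * |hermiteFunMulti k x|) := by
          rw [Finset.sum_mul, Finset.mul_sum]
      _ ≤ ∑ j : Fin d, 2 * (C * 3 ^ M) * level k ^ (M + 1) := Finset.sum_le_sum fun j _ => hj j
      _ = _ := by simp; ring

/-- The Schwartz seminorms of the Hermite functions grow at most polynomially in the index. -/
theorem seminorm_hermite_le (m n : ℕ) :
    ∃ C M, 0 ≤ C ∧ ∀ k : Fin d → ℕ,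
      SchwartzMap.seminorm 𝕜 m n (hermite 𝕜 k) ≤ C * level k ^ (M : ℕ) := by
  induction n with
  | zero =>
    obtain ⟨C, M, hC, h⟩ := norm_pow_mul_hermiteFunMulti_le (d := d) m
    refine ⟨C, M, hC, fun k => SchwartzMap.seminorm_le_bound 𝕜 m 0 _ ?_ fun x => ?_⟩
    · exact (by positivity : 0 ≤ ‖(0 : EuclideanSpace ℝ (Fin d))‖ ^ m *
        |hermiteFunMulti k 0|).trans (h k 0)
    · simpa using h k x
  | succ n ih =>
    obtain ⟨C, M, hC, h⟩ := ih
    refine ⟨d * (2 * (C * 3 ^ M)), M + 1, by positivity, fun k => ?_⟩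
    have hj : ∀ j, SchwartzMap.seminorm 𝕜 m n
        (∂_{EuclideanSpace.single j (1 : ℝ)} (hermite 𝕜 k)) ≤
        2 * (C * 3 ^ M) * level k ^ (M + 1) := fun j => by
      obtain ⟨a1, a2⟩ := ladderCoeff_le_level k j
      obtain ⟨b1, b2⟩ := level_pow_shift_le k j M
      have h1 := one_le_level j.pos k
      rw [lineDeriv_hermite]
      refine (map_sub_le_add _ _ _).trans ?_
      rw [map_smul_eq_mul, map_smul_eq_mul, RCLike.norm_ofReal, RCLike.norm_ofReal,
        abs_of_nonneg (ladderCoeff_nonneg _), abs_of_nonneg (ladderCoeff_nonneg _)]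
      calc _ ≤ level k * (C * (3 ^ M * level k ^ M)) + level k * (C * (3 ^ M * level k ^ M)) := by
            gcongr
            · exact (h _).trans (by gcongr)
            · exact (h _).trans (by gcongr)
        _ = _ := by ring
    calc _ ≤ _ := seminorm_succ_le m n _
      _ ≤ ∑ j : Fin d, 2 * (C * 3 ^ M) * level k ^ (M + 1) := Finset.sum_le_sum fun j _ => hj j
      _ = _ := by simp; ring

/-- The Hermite coefficients of the translates of a tempered distribution grow at most
polynomially, locally uniformly in the translation vector. -/
theorem norm_translate_hermite_le (hd : 0 < d) (φ : TempDist 𝕜 d) (x : EuclideanSpace ℝ (Fin d)) :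
    ∃ C M, 0 ≤ C ∧ ∀ t : ℝ, |t| ≤ 1 → ∀ k : Fin d → ℕ,
      ‖translate (t • x) φ (hermite 𝕜 k)‖ ≤ C * level k ^ (M : ℕ) := by
  obtain ⟨s, A, hA, hφ⟩ := exists_seminorm_bound φ
  choose C M hC h using fun i : ℕ × ℕ => seminorm_hermite_le (𝕜 := 𝕜) (d := d) i.1 i.2
  set B : ℕ × ℕ → ℝ := fun i => 2 ^ i.1 * (C i + ‖x‖ ^ i.1 * C (0, i.2)) with hB
  set N : ℕ := ∑ i ∈ s, (M i + M (0, i.2)) with hN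
  refine ⟨A * ∑ i ∈ s, B i, N, ?_, fun t ht k => (hφ _).trans ?_⟩
  · have : ∀ i, 0 ≤ B i := fun i => by
      have := hC i; have := hC (0, i.2); positivity
    exact mul_nonneg hA (Finset.sum_nonneg fun i _ => this i)
  rw [mul_assoc, Finset.sum_mul]
  gcongr with i hi
  have h1 := one_le_level hd k
  have hx : ‖t • x‖ ≤ ‖x‖ := by
    rw [norm_smul]
    exact mul_le_of_le_one_left (norm_nonneg _) ht
  have hNi : M i + M (0, i.2) ≤ N :=
    Finset.single_le_sum (f := fun i => M i + M (0, i.2)) (fun _ _ => Nat.zero_le _) hi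
  have e1 : level k ^ M i ≤ level k ^ N := pow_le_pow_right₀ h1 (by omega)
  have e2 : level k ^ M (0, i.2) ≤ level k ^ N := pow_le_pow_right₀ h1 (by omega)
  calc _ ≤ _ := seminorm_compSubConst_le i.1 i.2 (t • x) _
    _ ≤ 2 ^ i.1 * (C i * level k ^ N + ‖x‖ ^ i.1 * (C (0, i.2) * level k ^ N)) := by
        have c1 := hC i
        have c2 := hC (0, i.2)
        gcongr
        · exact (h i k).trans (by gcongr)
        · exact (h (0, i.2) k).trans (by gcongr)
    _ = B i * level k ^ N := by rw [hB]; ring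

end Schwartz

/-! ### The energy inequality -/

section Energy

variable {d : ℕ} {F : Type*} [NormedAddCommGroup F]

theorem add_single_injective (j : Fin d) :
    Function.Injective (fun k : Fin d → ℕ => k + Pi.single j 1) :=
  add_left_injective _

theorem norm_shift_le {v : (Fin d → ℕ) → F} {C : ℝ} {M : ℕ} (hC : 0 ≤ C)
    (hv : ∀ k, ‖v k‖ ≤ C * level k ^ M) (k : Fin d → ℕ) (j : Fin d) :
    ‖v k‖ ≤ C * 3 ^ M * level k ^ M ∧ ‖v (k - Pi.single j 1)‖ ≤ C * 3 ^ M * level k ^ M ∧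
      ‖v (k + Pi.single j 1)‖ ≤ C * 3 ^ M * level k ^ M := by
  obtain ⟨b1, b2⟩ := level_pow_shift_le k j M
  have h1 := one_le_level j.pos k
  simp only [mul_assoc]
  refine ⟨(hv k).trans ?_, (hv _).trans (by gcongr), (hv _).trans (by gcongr)⟩
  gcongr
  exact le_mul_of_one_le_left (by positivity) (one_le_pow₀ (by norm_num))

variable [InnerProductSpace ℝ F]

/-- The derivative `x · ∇` in Hermite coefficients: if `v_k = ⟨φ, h_k⟩`, then
`ladderOp x v k = ⟨φ, (x · ∇) h_k⟩`. For `k_j = 0` the truncated index `k - e_j` comes with the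
coefficient `0`. -/
noncomputable def ladderOp (x : EuclideanSpace ℝ (Fin d)) (v : (Fin d → ℕ) → F) (k : Fin d → ℕ) :
    F :=
  ∑ j, x j • (ladderCoeff (k j) • v (k - Pi.single j 1) -
    ladderCoeff (k j + 1) • v (k + Pi.single j 1))

theorem norm_ladderOp_le {v : (Fin d → ℕ) → F} {C : ℝ} {M : ℕ} (hC : 0 ≤ C)
    (hv : ∀ k, ‖v k‖ ≤ C * level k ^ M) (x : EuclideanSpace ℝ (Fin d)) (k : Fin d → ℕ) :
    ‖ladderOp x v k‖ ≤ (∑ j, |x j|) * (2 * (C * 3 ^ M) * level k ^ (M + 1)) := by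
  rw [Finset.sum_mul]
  refine (norm_sum_le _ _).trans (Finset.sum_le_sum fun j _ => ?_)
  obtain ⟨-, c1, c2⟩ := norm_shift_le hC hv k j
  obtain ⟨a1, a2⟩ := ladderCoeff_le_level k j
  have h1 := one_le_level j.pos k
  rw [norm_smul, Real.norm_eq_abs]
  gcongr
  refine (norm_sub_le _ _).trans ?_
  rw [norm_smul, norm_smul, Real.norm_of_nonneg (ladderCoeff_nonneg _),
    Real.norm_of_nonneg (ladderCoeff_nonneg _)]
  calc _ ≤ level k * (C * 3 ^ M * level k ^ M) + level k * (C * 3 ^ M * level k ^ M) := by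
        gcongr
    _ = _ := by ring

/-- Instantaneous form of the energy inequality. The operator `ladderOp x` is antisymmetric, so
that the quadratic form `∑ w_k ⟨v_k, (ladderOp x v)_k⟩` only involves the differences
`w_{k+e_j} - w_k`, and these are dominated by `δ`. -/
theorem tsum_energy_nonpos (hd : 0 < d) (x : EuclideanSpace ℝ (Fin d)) {v : (Fin d → ℕ) → F}
    {w δ B : (Fin d → ℕ) → ℝ} {C : ℝ} {M : ℕ} (hC : 0 ≤ C)
    (hv : ∀ k, ‖v k‖ ≤ C * level k ^ M) (hw : ∀ k, |w k| ≤ B k) (hδ0 : ∀ k, 0 ≤ δ k)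
    (hδ : ∀ k, δ k ≤ B k) (hB : ∀ N : ℕ, Summable fun k => B k * level k ^ N)
    (hedge : ∀ k j, 2 * d * |x j| * ladderCoeff (k j + 1) * |w (k + Pi.single j 1) - w k| ≤
      min (δ k) (δ (k + Pi.single j 1))) :
    ∑' k, (-δ k * ‖v k‖ ^ 2 + w k * (2 * inner ℝ (v k) (ladderOp x v k))) ≤ 0 := by
  have hB0 : ∀ k, 0 ≤ B k := fun k => (hδ0 k).trans (hδ k)
  have hl : ∀ k : Fin d → ℕ, 1 ≤ level k := one_le_level hd
  -- summability of the diagonal terms and of the two kinds of off-diagonal terms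
  have s1 : Summable fun k => δ k * ‖v k‖ ^ 2 := by
    refine Summable.of_nonneg_of_le (fun k => mul_nonneg (hδ0 k) (sq_nonneg _)) (fun k => ?_)
      ((hB (2 * M)).mul_left (C ^ 2))
    calc δ k * ‖v k‖ ^ 2 ≤ B k * (C * level k ^ M) ^ 2 := by
          have := hv k; have := hδ k; have := hB0 k
          gcongr
      _ = _ := by ring
  have hoff : ∀ c : (Fin d → ℕ) → ℝ, (∀ k, |c k| ≤ level k) →
      ∀ z : (Fin d → ℕ) → F, (∀ k, ‖z k‖ ≤ C * 3 ^ M * level k ^ M) →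
      Summable fun k => w k * (c k * inner ℝ (v k) (z k)) := by
    intro c hc z hz
    refine Summable.of_norm_bounded ((hB (2 * M + 1)).mul_left ((C * 3 ^ M) ^ 2)) fun k => ?_
    obtain ⟨c1, -, -⟩ := norm_shift_le hC hv k ⟨0, hd⟩
    have := hl k; have := hB0 k
    rw [Real.norm_eq_abs, abs_mul, abs_mul]
    calc _ ≤ B k * (level k * (‖v k‖ * ‖z k‖)) := by
          gcongr
          · exact hw k
          · exact hc k
          · exact abs_real_inner_le_norm _ _
      _ ≤ B k * (level k * ((C * 3 ^ M * level k ^ M) * (C * 3 ^ M * level k ^ M))) := by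
          gcongr
          exact hz k
      _ = _ := by ring
  have s2 : ∀ j, Summable fun k =>
      w k * (ladderCoeff (k j) * inner ℝ (v k) (v (k - Pi.single j 1))) := fun j =>
    hoff _ (fun k => by
      rw [abs_of_nonneg (ladderCoeff_nonneg _)]
      exact (ladderCoeff_le_level k j).1) _ fun k => (norm_shift_le hC hv k j).2.1
  have s3 : ∀ j, Summable fun k =>
      w k * (ladderCoeff (k j + 1) * inner ℝ (v k) (v (k + Pi.single j 1))) := fun j =>
    hoff _ (fun k => by
      rw [abs_of_nonneg (ladderCoeff_nonneg _)]
      exact (ladderCoeff_le_level k j).2) _ fun k => (norm_shift_le hC hv k j).2.2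
  -- shifting the index by `e_j` in the lowering terms
  have hsupp : ∀ j, Function.support (fun k =>
      w k * (ladderCoeff (k j) * inner ℝ (v k) (v (k - Pi.single j 1)))) ⊆
      Set.range (fun k : Fin d → ℕ => k + Pi.single j 1) := by
    intro j k hk
    have hkj : k j ≠ 0 := fun h0 => hk (by simp [h0])
    refine ⟨k - Pi.single j 1, ?_⟩
    ext i
    rcases eq_or_ne i j with rfl | hi
    · simp only [Pi.add_apply, Pi.sub_apply, Pi.single_eq_same]
      omega
    · simp [hi]
  have hcancel : ∀ (k : Fin d → ℕ) j, k + Pi.single j 1 - Pi.single j 1 = k := fun k j =>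
    add_tsub_cancel_right k _
  have s2' : ∀ j, Summable fun k =>
      w (k + Pi.single j 1) * (ladderCoeff (k j + 1) *
        inner ℝ (v (k + Pi.single j 1)) (v k)) := fun j => by
    have := (s2 j).comp_injective (add_single_injective j)
    simpa [Function.comp_def, hcancel] using this
  have hshift : ∀ j, ∑' k, w k * (ladderCoeff (k j) * inner ℝ (v k) (v (k - Pi.single j 1))) =
      ∑' k, w (k + Pi.single j 1) * (ladderCoeff (k j + 1) *
        inner ℝ (v (k + Pi.single j 1)) (v k)) := fun j => by
    rw [← (add_single_injective j).tsum_eq (hsupp j)]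
    simp [hcancel]
  have hj : ∀ j, 2 * x j * (∑' k, w k * (ladderCoeff (k j) *
        inner ℝ (v k) (v (k - Pi.single j 1))) -
      ∑' k, w k * (ladderCoeff (k j + 1) * inner ℝ (v k) (v (k + Pi.single j 1)))) ≤
      (d : ℝ)⁻¹ * ∑' k, δ k * ‖v k‖ ^ 2 := by
    intro j
    have s1' : Summable fun k => δ (k + Pi.single j 1) * ‖v (k + Pi.single j 1)‖ ^ 2 :=
      s1.comp_injective (add_single_injective j)
    have hle : ∑' k, δ (k + Pi.single j 1) * ‖v (k + Pi.single j 1)‖ ^ 2 ≤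
        ∑' k, δ k * ‖v k‖ ^ 2 :=
      tsum_comp_le_tsum_of_inj s1 (fun k => mul_nonneg (hδ0 k) (sq_nonneg _))
        (add_single_injective j)
    rw [hshift, ← (s2' j).tsum_sub (s3 j), ← tsum_mul_left]
    have hd' : (0 : ℝ) < d := by exact_mod_cast hd
    calc _ ≤ ∑' k, ((2 * d : ℝ)⁻¹ * (δ k * ‖v k‖ ^ 2) +
          (2 * d : ℝ)⁻¹ * (δ (k + Pi.single j 1) * ‖v (k + Pi.single j 1)‖ ^ 2)) := by
          refine Summable.tsum_le_tsum (fun k => ?_) (((s2' j).sub (s3 j)).mul_left _)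
            ((s1.mul_left _).add (s1'.mul_left _))
          obtain ⟨e1, e2⟩ := le_min_iff.1 (hedge k j)
          rw [real_inner_comm (v k) (v (k + Pi.single j 1))]
          set p := ‖v k‖
          set q := ‖v (k + Pi.single j 1)‖
          set α := ladderCoeff (k j + 1)
          have hα : 0 ≤ α := ladderCoeff_nonneg _
          set Δ := w (k + Pi.single j 1) - w k with hΔ
          set R := |x j| * α * |Δ|
          have hR0 : 0 ≤ R := by positivity
          have hin := abs_real_inner_le_norm (v k) (v (k + Pi.single j 1))
          have hpq : 2 * (p * q) ≤ p ^ 2 + q ^ 2 := by nlinarith [sq_nonneg (p - q)]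
          have r1 : R ≤ (2 * d : ℝ)⁻¹ * δ k := by
            rw [le_inv_mul_iff₀ (by positivity)]
            calc _ = _ := by ring
              _ ≤ _ := e1
          have r2 : R ≤ (2 * d : ℝ)⁻¹ * δ (k + Pi.single j 1) := by
            rw [le_inv_mul_iff₀ (by positivity)]
            calc _ = _ := by ring
              _ ≤ _ := e2
          calc _ = 2 * (x j * α * Δ * inner ℝ (v k) (v (k + Pi.single j 1))) := by
                rw [hΔ]; ring
            _ ≤ 2 * |x j * α * Δ * inner ℝ (v k) (v (k + Pi.single j 1))| := by
                gcongr
                exact le_abs_self _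
            _ = 2 * (R * |inner ℝ (v k) (v (k + Pi.single j 1))|) := by
                rw [abs_mul, abs_mul, abs_mul, abs_of_nonneg hα]
            _ ≤ 2 * (R * (p * q)) := by gcongr
            _ = R * (2 * (p * q)) := by ring
            _ ≤ R * (p ^ 2 + q ^ 2) := by gcongr
            _ = R * p ^ 2 + R * q ^ 2 := by ring
            _ ≤ (2 * d : ℝ)⁻¹ * δ k * p ^ 2 +
                (2 * d : ℝ)⁻¹ * δ (k + Pi.single j 1) * q ^ 2 := by gcongr
            _ = _ := by ring
      _ = (2 * d : ℝ)⁻¹ * ∑' k, δ k * ‖v k‖ ^ 2 + (2 * d : ℝ)⁻¹ *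
          ∑' k, δ (k + Pi.single j 1) * ‖v (k + Pi.single j 1)‖ ^ 2 := by
          rw [(s1.mul_left _).tsum_add (s1'.mul_left _), tsum_mul_left, tsum_mul_left]
      _ ≤ (2 * d : ℝ)⁻¹ * ∑' k, δ k * ‖v k‖ ^ 2 +
          (2 * d : ℝ)⁻¹ * ∑' k, δ k * ‖v k‖ ^ 2 := by gcongr
      _ = _ := by field_simp; ring
  have hterm : ∀ k, -δ k * ‖v k‖ ^ 2 + w k * (2 * inner ℝ (v k) (ladderOp x v k)) =
      -(δ k * ‖v k‖ ^ 2) + ∑ j, 2 * x j *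
        (w k * (ladderCoeff (k j) * inner ℝ (v k) (v (k - Pi.single j 1))) -
          w k * (ladderCoeff (k j + 1) * inner ℝ (v k) (v (k + Pi.single j 1)))) := by
    intro k
    simp only [ladderOp, inner_sum, real_inner_smul_right, inner_sub_right, Finset.mul_sum]
    rw [neg_mul]
    congr 1
    exact Finset.sum_congr rfl fun j _ => by ring
  have s4 : ∀ j ∈ Finset.univ, Summable fun k => 2 * x j *
      (w k * (ladderCoeff (k j) * inner ℝ (v k) (v (k - Pi.single j 1))) -
        w k * (ladderCoeff (k j + 1) * inner ℝ (v k) (v (k + Pi.single j 1)))) := fun j _ =>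
    ((s2 j).sub (s3 j)).mul_left _
  simp_rw [hterm]
  rw [s1.neg.tsum_add (summable_sum s4), tsum_neg, Summable.tsum_finsetSum s4]
  simp_rw [tsum_mul_left]
  have : ∑ j : Fin d, (d : ℝ)⁻¹ * ∑' k, δ k * ‖v k‖ ^ 2 = ∑' k, δ k * ‖v k‖ ^ 2 := by
    have hd' : (d : ℝ) ≠ 0 := by positivity
    rw [Finset.sum_const, Finset.card_univ, Fintype.card_fin, nsmul_eq_mul,
      mul_inv_cancel_left₀ hd']
  have h5 : ∑ j, 2 * x j * ∑' k,
      (w k * (ladderCoeff (k j) * inner ℝ (v k) (v (k - Pi.single j 1))) -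
        w k * (ladderCoeff (k j + 1) * inner ℝ (v k) (v (k + Pi.single j 1)))) ≤
      ∑ j : Fin d, (d : ℝ)⁻¹ * ∑' k, δ k * ‖v k‖ ^ 2 := Finset.sum_le_sum fun j _ => by
    rw [(s2 j).tsum_sub (s3 j)]
    exact hj j
  linarith

/-- If `u' = ladderOp x u` and the weights `w` decrease in time fast enough to absorb their
differences between neighbouring indices, then the weighted energy `∑ w_k ‖u_k‖²` decreases. -/
theorem tsum_weight_le (hd : 0 < d) (x : EuclideanSpace ℝ (Fin d)) {u : (Fin d → ℕ) → ℝ → F}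
    {w δ : (Fin d → ℕ) → ℝ → ℝ} {B : (Fin d → ℕ) → ℝ} {C : ℝ} {M : ℕ} (hC : 0 ≤ C)
    (hode : ∀ k t, HasDerivAt (u k) (ladderOp x (fun k => u k t) k) t)
    (hu : ∀ t ∈ Icc (0 : ℝ) 1, ∀ k, ‖u k t‖ ≤ C * level k ^ M)
    (hwd : ∀ k, ∀ t ∈ Icc (0 : ℝ) 1, HasDerivAt (w k) (-δ k t) t)
    (hw : ∀ k, ∀ t ∈ Icc (0 : ℝ) 1, |w k t| ≤ B k)
    (hδ0 : ∀ k, ∀ t ∈ Icc (0 : ℝ) 1, 0 ≤ δ k t) (hδ : ∀ k, ∀ t ∈ Icc (0 : ℝ) 1, δ k t ≤ B k)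
    (hB : ∀ N : ℕ, Summable fun k => B k * level k ^ N)
    (hedge : ∀ k j, ∀ t ∈ Icc (0 : ℝ) 1,
      2 * d * |x j| * ladderCoeff (k j + 1) * |w (k + Pi.single j 1) t - w k t| ≤
      min (δ k t) (δ (k + Pi.single j 1) t)) :
    ∑' k, w k 1 * ‖u k 1‖ ^ 2 ≤ ∑' k, w k 0 * ‖u k 0‖ ^ 2 := by
  have hl : ∀ k : Fin d → ℕ, 1 ≤ level k := one_le_level hd
  have hB0 : ∀ k, 0 ≤ B k := fun k =>
    (hδ0 k 0 (left_mem_Icc.2 zero_le_one)).trans (hδ k 0 (left_mem_Icc.2 zero_le_one))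
  set f' : (Fin d → ℕ) → ℝ → ℝ := fun k t => -δ k t * ‖u k t‖ ^ 2 +
    w k t * (2 * inner ℝ (u k t) (ladderOp x (fun k => u k t) k)) with hf'
  have hderiv : ∀ k, ∀ t ∈ Icc (0 : ℝ) 1,
      HasDerivAt (fun t => w k t * ‖u k t‖ ^ 2) (f' k t) t := fun k t ht =>
    (hwd k t ht).mul (hode k t).norm_sq
  have hterm : ∀ k, ∀ t ∈ Icc (0 : ℝ) 1,
      ‖w k t * ‖u k t‖ ^ 2‖ ≤ C ^ 2 * (B k * level k ^ (2 * M)) := fun k t ht => by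
    have := hB0 k; have := hl k; have := hu t ht k; have := hw k t ht
    rw [norm_mul, Real.norm_eq_abs, Real.norm_of_nonneg (sq_nonneg ‖u k t‖)]
    calc _ ≤ B k * (C * level k ^ M) ^ 2 := by gcongr
      _ = _ := by ring
  have hbound : ∀ k, ∀ t ∈ Icc (0 : ℝ) 1, ‖f' k t‖ ≤
      C ^ 2 * (B k * level k ^ (2 * M)) +
        4 * (∑ j, |x j|) * C ^ 2 * 3 ^ M * (B k * level k ^ (2 * M + 1)) := fun k t ht => by
    have h0 := hB0 k; have h1 := hl k; have h2 := hu t ht k; have h3 := hw k t ht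
    have h4 := norm_ladderOp_le hC (hu t ht) x k
    have h5 := hδ k t ht
    have hs : 0 ≤ ∑ j, |x j| := Finset.sum_nonneg fun _ _ => abs_nonneg _
    refine (norm_add_le _ _).trans (add_le_add ?_ ?_)
    · rw [norm_mul, norm_neg, Real.norm_of_nonneg (hδ0 k t ht),
        Real.norm_of_nonneg (sq_nonneg ‖u k t‖)]
      calc _ ≤ B k * (C * level k ^ M) ^ 2 := by gcongr
        _ = _ := by ring
    · rw [norm_mul, norm_mul, Real.norm_eq_abs, Real.norm_ofNat, Real.norm_eq_abs]
      calc _ ≤ B k * (2 * (‖u k t‖ * ‖ladderOp x (fun k => u k t) k‖)) := by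
            gcongr
            exact abs_real_inner_le_norm _ _
        _ ≤ B k * (2 * ((C * level k ^ M) * ((∑ j, |x j|) *
            (2 * (C * 3 ^ M) * level k ^ (M + 1))))) := by gcongr
        _ = _ := by ring
  have hsum := ((hB (2 * M)).mul_left (C ^ 2)).add
    ((hB (2 * M + 1)).mul_left (4 * (∑ j, |x j|) * C ^ 2 * 3 ^ M))
  have hD : ∀ t ∈ Ioo (0 : ℝ) 1,
      HasDerivAt (fun t => ∑' k, w k t * ‖u k t‖ ^ 2) (∑' k, f' k t) t := fun t ht =>
    hasDerivAt_tsum_of_isPreconnected hsum isOpen_Ioo isPreconnected_Ioo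
      (fun k t ht => hderiv k t (Ioo_subset_Icc_self ht))
      (fun k t ht => hbound k t (Ioo_subset_Icc_self ht)) ht
      (Summable.of_norm_bounded ((hB (2 * M)).mul_left (C ^ 2))
        fun k => hterm k t (Ioo_subset_Icc_self ht)) ht
  have hanti : AntitoneOn (fun t => ∑' k, w k t * ‖u k t‖ ^ 2) (Icc 0 1) := by
    refine antitoneOn_of_deriv_nonpos (convex_Icc 0 1) ?_ ?_ ?_
    · exact continuousOn_tsum
        (fun k t ht => (hderiv k t ht).continuousAt.continuousWithinAt)
        ((hB (2 * M)).mul_left (C ^ 2)) hterm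
    · rw [interior_Icc]
      exact fun t ht => (hD t ht).differentiableAt.differentiableWithinAt
    · rw [interior_Icc]
      intro t ht
      have ht' := Ioo_subset_Icc_self ht
      rw [(hD t ht).deriv]
      exact tsum_energy_nonpos hd x hC (hu t ht') (fun k => hw k t ht') (fun k => hδ0 k t ht')
        (fun k => hδ k t ht') hB (fun k j => hedge k j t ht')
  exact hanti (left_mem_Icc.2 zero_le_one) (right_mem_Icc.2 zero_le_one) zero_le_one

end Energy

/-! ### The moving weights -/

theorem rpow_le_two_rpow_mul {y z : ℝ} (hy : 0 < y) (hz : 0 < z) (h1 : y ≤ 2 * z)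
    (h2 : z ≤ 2 * y) (c : ℝ) : y ^ c ≤ 2 ^ |c| * z ^ c := by
  rcases le_total 0 c with hc | hc
  · rw [abs_of_nonneg hc, ← Real.mul_rpow (by norm_num) hz.le]
    exact Real.rpow_le_rpow hy.le h1 hc
  · rw [abs_of_nonpos hc, Real.rpow_neg (by norm_num), ← Real.inv_rpow (by norm_num),
      ← Real.mul_rpow (by norm_num) hz.le]
    exact Real.rpow_le_rpow_of_nonpos (by positivity) (by linarith) hc

/-- A majorant of the derivative in `r` of `(r + q)^a e^{-εr}`. -/
noncomputable def weightSlope (a ε q r : ℝ) : ℝ :=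
  (|a| * (r + q) ^ (a - 1) + ε * (r + q) ^ a) * Real.exp (-(ε * r))

theorem weightSlope_nonneg {a ε q r : ℝ} (hε : 0 ≤ ε) (hq : 0 ≤ q) (hr : 0 ≤ r) :
    0 ≤ weightSlope a ε q r := by
  unfold weightSlope
  positivity

theorem weightSlope_le {a ε q r r' : ℝ} (hε : 0 ≤ ε) (hε1 : ε ≤ 1) (hq : 0 ≤ q) (hr : 0 < r)
    (hr' : 0 < r') (h1 : r ≤ 2 * r') (h2 : r' ≤ 2 * r) (h3 : r' ≤ r + 1) :
    weightSlope a ε q r ≤ 2 ^ (|a| + 1) * Real.exp 1 * weightSlope a ε q r' := by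
  have e1 : (r + q) ^ a ≤ 2 ^ (|a| + 1) * (r' + q) ^ a := by
    refine (rpow_le_two_rpow_mul (z := r' + q) (by linarith) (by linarith) (by linarith)
      (by linarith) a).trans ?_
    gcongr
    · norm_num
    · linarith
  have e2 : (r + q) ^ (a - 1) ≤ 2 ^ (|a| + 1) * (r' + q) ^ (a - 1) := by
    refine (rpow_le_two_rpow_mul (z := r' + q) (by linarith) (by linarith) (by linarith)
      (by linarith) (a - 1)).trans ?_
    gcongr
    · norm_num
    · simpa using abs_sub a 1
  have e3 : Real.exp (-(ε * r)) ≤ Real.exp 1 * Real.exp (-(ε * r')) := by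
    rw [← Real.exp_add]
    gcongr
    nlinarith
  unfold weightSlope
  calc _ ≤ (|a| * (2 ^ (|a| + 1) * (r' + q) ^ (a - 1)) +
        ε * (2 ^ (|a| + 1) * (r' + q) ^ a)) * (Real.exp 1 * Real.exp (-(ε * r'))) := by gcongr
    _ = _ := by ring

theorem abs_weight_sub_le {a ε q s s' : ℝ} (hε : 0 ≤ ε) (hε1 : ε ≤ 1) (hq : 0 ≤ q) (hs : 1 ≤ s)
    (hss : s ≤ s') (h2 : s' ≤ 2 * s) (h3 : s' ≤ s + 1) :
    |(s' + q) ^ a * Real.exp (-(ε * s')) - (s + q) ^ a * Real.exp (-(ε * s))| ≤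
      2 ^ (|a| + 1) * Real.exp 1 * min (weightSlope a ε q s) (weightSlope a ε q s') *
        (s' - s) := by
  have hd : ∀ r ∈ Icc s s', HasDerivWithinAt (fun r => (r + q) ^ a * Real.exp (-(ε * r)))
      ((a * (r + q) ^ (a - 1) - ε * (r + q) ^ a) * Real.exp (-(ε * r))) (Icc s s') r := by
    intro r hr
    have hr0 : r + q ≠ 0 := by have := hr.1; linarith
    have d1 : HasDerivAt (fun r => (r + q) ^ a) (1 * a * (r + q) ^ (a - 1)) r :=
      ((hasDerivAt_id r).add_const q).rpow_const (Or.inl hr0)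
    have d2 : HasDerivAt (fun r => Real.exp (-(ε * r))) (Real.exp (-(ε * r)) * (-(ε * 1))) r :=
      ((hasDerivAt_id r).const_mul ε).neg.exp
    refine ((d1.mul d2).congr_deriv ?_).hasDerivWithinAt
    ring
  have hb : ∀ r ∈ Icc s s', ‖(a * (r + q) ^ (a - 1) - ε * (r + q) ^ a) * Real.exp (-(ε * r))‖ ≤
      2 ^ (|a| + 1) * Real.exp 1 * min (weightSlope a ε q s) (weightSlope a ε q s') := by
    intro r hr
    have hr0 : 0 < r + q := by have := hr.1; linarith
    have hr1 : 0 < r := by have := hr.1; linarith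
    have e : ‖(a * (r + q) ^ (a - 1) - ε * (r + q) ^ a) * Real.exp (-(ε * r))‖ ≤
        weightSlope a ε q r := by
      rw [norm_mul, Real.norm_of_nonneg (Real.exp_pos _).le, weightSlope]
      gcongr
      refine (norm_sub_le _ _).trans (le_of_eq ?_)
      rw [norm_mul, norm_mul, Real.norm_of_nonneg (Real.rpow_nonneg hr0.le _),
        Real.norm_of_nonneg (Real.rpow_nonneg hr0.le _), Real.norm_eq_abs,
        Real.norm_of_nonneg hε]
    rw [mul_min_of_nonneg _ _ (by positivity)]
    obtain ⟨g1, g2⟩ := hr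
    exact e.trans (le_min
      (weightSlope_le hε hε1 hq hr1 (by linarith) (by linarith) (by linarith) (by linarith))
      (weightSlope_le hε hε1 hq hr1 (by linarith) (by linarith) (by linarith) (by linarith)))
  have := Convex.norm_image_sub_le_of_norm_hasDerivWithin_le hd hb (convex_Icc s s')
    (left_mem_Icc.2 hss) (right_mem_Icc.2 hss)
  rwa [Real.norm_eq_abs, Real.norm_eq_abs, abs_of_nonneg (sub_nonneg.2 hss)] at this

section Level

variable {d : ℕ}

theorem one_le_sqrt_level (hd : 0 < d) (k : Fin d → ℕ) : 1 ≤ √(level k) :=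
  Real.one_le_sqrt.2 (one_le_level hd k)

/-- Neighbouring values of `√(2|k|+d)`: their gap is inversely proportional to the size of the
ladder coefficients. -/
theorem sqrt_level_add_single (k : Fin d → ℕ) (j : Fin d) :
    √(level k) ≤ √(level (k + Pi.single j 1)) ∧
      √(level (k + Pi.single j 1)) ≤ 2 * √(level k) ∧
      √(level (k + Pi.single j 1)) ≤ √(level k) + 1 ∧
      ladderCoeff (k j + 1) * (√(level (k + Pi.single j 1)) - √(level k)) ≤ 1 := by
  rw [level_add_single]
  have h1 := one_le_level j.pos k
  have hs1 := one_le_sqrt_level j.pos k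
  have hs := Real.sq_sqrt (show 0 ≤ level k by linarith)
  have hs' := Real.sq_sqrt (show 0 ≤ level k + 2 by linarith)
  have h0' := Real.sqrt_nonneg (level k + 2)
  have hle : √(level k) ≤ √(level k + 2) := Real.sqrt_le_sqrt (by linarith)
  set s := √(level k)
  set s' := √(level k + 2)
  refine ⟨hle, by nlinarith, by nlinarith, ?_⟩
  have hα : ladderCoeff (k j + 1) ≤ s' / 2 := by
    refine abs_le_of_sq_le_sq' ?_ (by positivity) |>.2
    rw [ladderCoeff_sq, div_pow, hs']
    have := coord_le_level k j
    push_cast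
    linarith
  have hdiff : (s' + s) * (s' - s) = 2 := by linarith [sq_sub_sq s' s]
  calc _ ≤ s' / 2 * (s' - s) := by gcongr
    _ ≤ 1 := by nlinarith

theorem summable_pi_prod {g : ℕ → ℝ} (hg0 : ∀ n, 0 ≤ g n) (hg : Summable g) :
    Summable fun k : Fin d → ℕ => ∏ i, g (k i) := by
  have h1 : ∀ S : Finset (Fin d → ℕ), ∑ k ∈ S, ∏ i, g (k i) ≤ ∏ i : Fin d, ∑' n, g n := by
    intro S
    let t : Fin d → Finset ℕ := fun i => S.image (fun k => k i)
    have hsub : S ⊆ Fintype.piFinset t := fun k hk =>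
      Fintype.mem_piFinset.2 fun i => Finset.mem_image_of_mem (fun k : Fin d → ℕ => k i) hk
    have e1 := Finset.prod_univ_sum t fun _ n => g n
    have e2 : ∑ k ∈ S, ∏ i, g (k i) ≤ ∑ k ∈ Fintype.piFinset t, ∏ i, g (k i) :=
      Finset.sum_le_sum_of_subset_of_nonneg hsub fun k _ _ =>
          Finset.prod_nonneg fun i _ => hg0 (k i)
    refine e2.trans (e1.ge.trans ?_)
    refine Finset.prod_le_prod (fun i _ => Finset.sum_nonneg fun n _ => hg0 n) fun i _ => ?_
    exact hg.sum_le_tsum _ fun n _ => hg0 n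
  exact summable_of_sum_le (fun k => Finset.prod_nonneg fun i _ => hg0 (k i)) h1

theorem summable_inv_level_pow (hd : 0 < d) :
    Summable fun k : Fin d → ℕ => ((level k) ^ (2 * d))⁻¹ := by
  have hs : Summable fun n : ℕ => (((n : ℝ) + 1) ^ 2)⁻¹ := by
    have := (summable_nat_add_iff 1).2 (Real.summable_nat_pow_inv (p := 2) |>.2 one_lt_two)
    simpa using this
  refine Summable.of_nonneg_of_le (fun k => ?_) (fun k => ?_)
    (summable_pi_prod (fun n => by positivity) hs)
  · have := one_le_level hd k
    positivity
  · have h1 := one_le_level hd k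
    rw [Finset.prod_inv_distrib]
    refine inv_anti₀ (Finset.prod_pos fun i _ => by positivity) ?_
    calc ∏ i, ((k i : ℝ) + 1) ^ 2 ≤ ∏ i : Fin d, level k ^ 2 := by
          refine Finset.prod_le_prod (fun i _ => by positivity) fun i _ => ?_
          have := coord_le_level k i
          have h0 : (0 : ℝ) ≤ k i := by positivity
          gcongr
          linarith
      _ = _ := by rw [Finset.prod_const, Finset.card_univ, Fintype.card_fin, ← pow_mul]

theorem summable_level_rpow_mul_exp (hd : 0 < d) {ε : ℝ} (hε : 0 < ε) (c : ℝ) (N : ℕ) :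
    Summable fun k : Fin d → ℕ =>
      √(level k) ^ c * Real.exp (-(ε * √(level k))) * level k ^ N := by
  set n : ℕ := ⌈c⌉₊ + 2 * N + 4 * d with hn
  refine Summable.of_nonneg_of_le (fun k => ?_) (fun k => ?_)
    ((summable_inv_level_pow hd).mul_left ((n.factorial : ℝ) / ε ^ n))
  · have := one_le_level hd k
    positivity
  · have h1 := one_le_level hd k
    have hs1 := one_le_sqrt_level hd k
    have hs := Real.sq_sqrt (show 0 ≤ level k by linarith)
    set s := √(level k)
    have hexp : s ^ n * Real.exp (-(ε * s)) ≤ (n.factorial : ℝ) / ε ^ n := by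
      have h2 := Real.pow_div_factorial_le_exp (ε * s) (by positivity) n
      rw [div_le_iff₀ (by positivity), mul_pow] at h2
      rw [Real.exp_neg, ← div_eq_mul_inv, div_le_div_iff₀ (Real.exp_pos _) (by positivity)]
      linarith
    have hc : s ^ c ≤ s ^ ⌈c⌉₊ := by
      rw [← Real.rpow_natCast]
      exact Real.rpow_le_rpow_of_exponent_le hs1 (Nat.le_ceil c)
    rw [← div_eq_mul_inv, le_div_iff₀ (by positivity), ← hs]
    calc _ ≤ s ^ ⌈c⌉₊ * Real.exp (-(ε * s)) * (s ^ 2) ^ N * (s ^ 2) ^ (2 * d) := by gcongr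
      _ = s ^ n * Real.exp (-(ε * s)) := by rw [hn]; ring
      _ ≤ _ := hexp

end Level

section Solution

variable {d : ℕ} {F : Type*} [NormedAddCommGroup F] [InnerProductSpace ℝ F]

/-- Regularised energy inequality for `u' = ladderOp x u`, with the weights
`(√(2|k|+d) + β + γt)^a e^{-ε(√(2|k|+d) + bt)}`. The sign of `aγ` makes the weights decrease in
time; the speed `b` is proportional to `‖x‖`. -/
theorem tsum_moving_weight_le (hd : 0 < d) {a β γ b ε C : ℝ} {M : ℕ}
    (x : EuclideanSpace ℝ (Fin d)) {u : (Fin d → ℕ) → ℝ → F} (hC : 0 ≤ C)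
    (hode : ∀ k t, HasDerivAt (u k) (ladderOp x (fun k => u k t) k) t)
    (hu : ∀ t ∈ Icc (0 : ℝ) 1, ∀ k, ‖u k t‖ ≤ C * level k ^ M)
    (hb : b = 2 * d * (2 ^ (|a| + 1) * Real.exp 1) * ‖x‖)
    (hβγ : ∀ t ∈ Icc (0 : ℝ) 1, 0 ≤ β + γ * t ∧ β + γ * t ≤ b) (haγ : a * γ = -(|a| * b))
    (hε : 0 < ε) (hε1 : ε ≤ 1) :
    ∑' k, (√(level k) + (β + γ)) ^ a * Real.exp (-(ε * (√(level k) + b))) * ‖u k 1‖ ^ 2 ≤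
      ∑' k, (√(level k) + β) ^ a * Real.exp (-(ε * √(level k))) * ‖u k 0‖ ^ 2 := by
  have hb0 : 0 ≤ b := by rw [hb]; positivity
  have hs1 : ∀ k : Fin d → ℕ, 1 ≤ √(level k) := one_le_sqrt_level hd
  have hexp : ∀ (k : Fin d → ℕ) (t : ℝ), Real.exp (-(ε * (√(level k) + b * t))) =
      Real.exp (-(ε * √(level k))) * Real.exp (-(ε * (b * t))) := fun k t => by
    rw [← Real.exp_add]
    ring_nf
  have hpow : ∀ k, ∀ t ∈ Icc (0 : ℝ) 1, (√(level k) + (β + γ * t)) ^ a ≤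
      (1 + b) ^ |a| * √(level k) ^ |a| := fun k t ht => by
    obtain ⟨q0, q1⟩ := hβγ t ht
    have h1 := hs1 k
    rw [← Real.mul_rpow (by positivity) (by positivity)]
    refine (Real.rpow_le_rpow_of_exponent_le (by linarith) (le_abs_self a)).trans ?_
    exact Real.rpow_le_rpow (by linarith) (by nlinarith) (abs_nonneg a)
  have hE1 : ∀ t ∈ Icc (0 : ℝ) 1, Real.exp (-(ε * (b * t))) ≤ 1 := fun t ht => by
    rw [Real.exp_le_one_iff]
    have := ht.1
    have : 0 ≤ ε * (b * t) := by positivity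
    linarith
  set B : (Fin d → ℕ) → ℝ := fun k => (1 + b * (|a| + 1)) * (1 + b) ^ |a| *
    (√(level k) ^ |a| * Real.exp (-(ε * √(level k)))) with hB
  have key := tsum_weight_le hd x (u := u)
    (w := fun k t => (√(level k) + (β + γ * t)) ^ a * Real.exp (-(ε * (√(level k) + b * t))))
    (δ := fun k t => b * weightSlope a ε (β + γ * t) (√(level k)) * Real.exp (-(ε * (b * t))))
    (B := B) hC hode hu ?_ ?_ ?_ ?_ ?_ ?_
  · simpa using key
  · intro k t ht
    obtain ⟨q0, q1⟩ := hβγ t ht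
    have h1 := hs1 k
    have hne : √(level k) + (β + γ * t) ≠ 0 := by linarith
    have d1 : HasDerivAt (fun t => (√(level k) + (β + γ * t)) ^ a)
        (γ * 1 * a * (√(level k) + (β + γ * t)) ^ (a - 1)) t :=
      ((((hasDerivAt_id t).const_mul γ).const_add β).const_add _).rpow_const (Or.inl hne)
    have d2 : HasDerivAt (fun t => Real.exp (-(ε * (√(level k) + b * t))))
        (Real.exp (-(ε * (√(level k) + b * t))) * (-(ε * (b * 1)))) t :=
      ((((hasDerivAt_id t).const_mul b).const_add _).const_mul ε).neg.exp
    refine (d1.mul d2).congr_deriv ?_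
    rw [hexp, weightSlope]
    linear_combination ((√(level k) + (β + γ * t)) ^ (a - 1) * Real.exp (-(ε * √(level k))) *
      Real.exp (-(ε * (b * t)))) * haγ
  · intro k t ht
    obtain ⟨q0, q1⟩ := hβγ t ht
    have h1 := hs1 k
    rw [abs_of_nonneg (by positivity), hexp]
    calc _ ≤ (1 + b) ^ |a| * √(level k) ^ |a| * (Real.exp (-(ε * √(level k))) * 1) := by
          gcongr
          · exact hpow k t ht
          · exact hE1 t ht
      _ = 1 * ((1 + b) ^ |a| * (√(level k) ^ |a| * Real.exp (-(ε * √(level k))))) := by ring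
      _ ≤ (1 + b * (|a| + 1)) * ((1 + b) ^ |a| *
          (√(level k) ^ |a| * Real.exp (-(ε * √(level k))))) := by
          gcongr
          have : 0 ≤ b * (|a| + 1) := by positivity
          linarith
      _ = _ := by rw [hB]; ring
  · intro k t ht
    have h1 := hs1 k
    have := weightSlope_nonneg (a := a) hε.le (hβγ t ht).1 (show 0 ≤ √(level k) by linarith)
    positivity
  · intro k t ht
    obtain ⟨q0, q1⟩ := hβγ t ht
    have h1 := hs1 k
    have h2 : (√(level k) + (β + γ * t)) ^ (a - 1) ≤ (√(level k) + (β + γ * t)) ^ a :=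
      Real.rpow_le_rpow_of_exponent_le (by linarith) (by linarith)
    have h3 : weightSlope a ε (β + γ * t) √(level k) ≤
        (|a| + 1) * ((1 + b) ^ |a| * √(level k) ^ |a|) * Real.exp (-(ε * √(level k))) := by
      unfold weightSlope
      have h4 := hpow k t ht
      have h5 : 0 ≤ (√(level k) + (β + γ * t)) ^ a := by positivity
      gcongr
      calc _ ≤ |a| * (√(level k) + (β + γ * t)) ^ a + 1 * (√(level k) + (β + γ * t)) ^ a := by
            gcongr
        _ = (|a| + 1) * (√(level k) + (β + γ * t)) ^ a := by ring
        _ ≤ _ := by gcongr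
    calc _ ≤ b * ((|a| + 1) * ((1 + b) ^ |a| * √(level k) ^ |a|) *
          Real.exp (-(ε * √(level k)))) * 1 := by
          gcongr
          exact hE1 t ht
      _ = (b * (|a| + 1)) * ((1 + b) ^ |a| *
          (√(level k) ^ |a| * Real.exp (-(ε * √(level k))))) := by ring
      _ ≤ (1 + b * (|a| + 1)) * ((1 + b) ^ |a| *
          (√(level k) ^ |a| * Real.exp (-(ε * √(level k))))) := by
          gcongr
          linarith
      _ = _ := by rw [hB]; ring
  · intro N
    refine ((summable_level_rpow_mul_exp hd hε |a| N).mul_left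
      ((1 + b * (|a| + 1)) * (1 + b) ^ |a|)).congr fun k => ?_
    rw [hB]
    ring
  · intro k j t ht
    obtain ⟨q0, q1⟩ := hβγ t ht
    obtain ⟨g1, g2, g3, g4⟩ := sqrt_level_add_single k j
    have h1 := hs1 k
    have hx : |x j| ≤ ‖x‖ := PiLp.norm_apply_le x j
    have hΔ := abs_weight_sub_le (a := a) hε.le hε1 q0 h1 g1 g2 g3
    have hm : 0 ≤ min (weightSlope a ε (β + γ * t) √(level k))
        (weightSlope a ε (β + γ * t) √(level (k + Pi.single j 1))) :=
      le_min (weightSlope_nonneg hε.le q0 (by linarith))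
        (weightSlope_nonneg hε.le q0 (by linarith))
    have hα := ladderCoeff_nonneg (k j + 1)
    have hsub : ∀ p q r s z : ℝ, p * (q * z) - r * (s * z) = (p * q - r * s) * z := by
      intros; ring
    rw [← min_mul_of_nonneg _ _ (Real.exp_pos _).le, ← mul_min_of_nonneg _ _ hb0, hexp, hexp,
      hsub, abs_mul, abs_of_pos (Real.exp_pos (-(ε * (b * t)))),
      ← mul_assoc (2 * (d : ℝ) * |x j| * ladderCoeff (k j + 1))]
    refine mul_le_mul_of_nonneg_right ?_ (Real.exp_pos _).le
    set K : ℝ := 2 ^ (|a| + 1) * Real.exp 1 with hK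
    set m := min (weightSlope a ε (β + γ * t) √(level k))
      (weightSlope a ε (β + γ * t) √(level (k + Pi.single j 1)))
    have hK0 : 0 ≤ K := by positivity
    calc _ ≤ 2 * d * ‖x‖ * ladderCoeff (k j + 1) *
          (K * m * (√(level (k + Pi.single j 1)) - √(level k))) := by gcongr
      _ = 2 * d * ‖x‖ * (K * m) *
          (ladderCoeff (k j + 1) * (√(level (k + Pi.single j 1)) - √(level k))) := by ring
      _ ≤ 2 * d * ‖x‖ * (K * m) * 1 := by gcongr
      _ = b * m := by rw [hb]; ring

/-- A polynomially growing solution of `u' = ladderOp x u` has its weighted `ℓ²`-norm at time `1`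
bounded by the one at time `0`, up to a power of `1 + c‖x‖`. -/
theorem sum_weight_le (hd : 0 < d) (a : ℝ) (x : EuclideanSpace ℝ (Fin d))
    {u : (Fin d → ℕ) → ℝ → F} {C : ℝ} {M : ℕ} (hC : 0 ≤ C)
    (hode : ∀ k t, HasDerivAt (u k) (ladderOp x (fun k => u k t) k) t)
    (hu : ∀ t ∈ Icc (0 : ℝ) 1, ∀ k, ‖u k t‖ ≤ C * level k ^ M)
    (h0 : Summable fun k => √(level k) ^ a * ‖u k 0‖ ^ 2) (S : Finset (Fin d → ℕ)) :
    ∑ k ∈ S, √(level k) ^ a * ‖u k 1‖ ^ 2 ≤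
      (1 + 2 * d * (2 ^ (|a| + 1) * Real.exp 1) * ‖x‖) ^ |a| *
        ∑' k, √(level k) ^ a * ‖u k 0‖ ^ 2 := by
  set b : ℝ := 2 * d * (2 ^ (|a| + 1) * Real.exp 1) * ‖x‖ with hb
  have hb0 : 0 ≤ b := by positivity
  have hs1 : ∀ k : Fin d → ℕ, 1 ≤ √(level k) := one_le_sqrt_level hd
  have hsb : ∀ k : Fin d → ℕ, √(level k) + b ≤ (1 + b) * √(level k) := fun k => by
    nlinarith [hs1 k]
  -- it is enough to bound the sum regularised by the factors `e^{-ε(√(2|k|+d) + b)}`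
  suffices hreg : ∀ ε : ℝ, 0 < ε → ε ≤ 1 →
      ∑ k ∈ S, √(level k) ^ a * Real.exp (-(ε * (√(level k) + b))) * ‖u k 1‖ ^ 2 ≤
        (1 + b) ^ |a| * ∑' k, √(level k) ^ a * ‖u k 0‖ ^ 2 by
    have hlim : Tendsto (fun ε : ℝ =>
        ∑ k ∈ S, √(level k) ^ a * Real.exp (-(ε * (√(level k) + b))) * ‖u k 1‖ ^ 2) (𝓝[>] 0)
        (𝓝 (∑ k ∈ S, √(level k) ^ a * Real.exp (-(0 * (√(level k) + b))) * ‖u k 1‖ ^ 2)) := by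
      have : Continuous fun ε : ℝ =>
        ∑ k ∈ S, √(level k) ^ a * Real.exp (-(ε * (√(level k) + b))) * ‖u k 1‖ ^ 2 := by
        fun_prop
      exact this.continuousAt.tendsto.mono_left nhdsWithin_le_nhds
    simp only [zero_mul, neg_zero, Real.exp_zero, mul_one] at hlim
    refine le_of_tendsto hlim ?_
    filter_upwards [Ioo_mem_nhdsGT one_pos] with ε hε
    exact hreg ε hε.1 hε.2.le
  intro ε hε hε1
  have hsum : Summable fun k =>
      √(level k) ^ a * Real.exp (-(ε * (√(level k) + b))) * ‖u k 1‖ ^ 2 := by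
    refine Summable.of_nonneg_of_le (fun k => by positivity) (fun k => ?_)
      ((summable_level_rpow_mul_exp hd hε a (2 * M)).mul_left (C ^ 2))
    have h1 := hu 1 (right_mem_Icc.2 zero_le_one) k
    have h2 := one_le_level hd k
    calc _ ≤ √(level k) ^ a * Real.exp (-(ε * √(level k))) * (C * level k ^ M) ^ 2 := by
          gcongr
          linarith
      _ = _ := by ring
  refine (hsum.sum_le_tsum S fun k _ => by positivity).trans ?_
  rw [← tsum_mul_left]
  have h0' : Summable fun k => (1 + b) ^ |a| * (√(level k) ^ a * ‖u k 0‖ ^ 2) := h0.mul_left _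
  have hE : ∀ k : Fin d → ℕ, Real.exp (-(ε * √(level k))) ≤ 1 := fun k => by
    rw [Real.exp_le_one_iff]
    have := hs1 k
    have : 0 ≤ ε * √(level k) := by positivity
    linarith
  rcases le_total 0 a with ha | ha
  · have key := tsum_moving_weight_le hd (a := a) (β := b) (γ := -b) x hC hode hu hb
      (fun t ht => by
        obtain ⟨t0, t1⟩ := ht
        constructor <;> nlinarith) (by rw [abs_of_nonneg ha]; ring) hε hε1
    rw [add_neg_cancel] at key
    simp only [add_zero] at key
    have hle : ∀ k, (√(level k) + b) ^ a * Real.exp (-(ε * √(level k))) * ‖u k 0‖ ^ 2 ≤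
        (1 + b) ^ |a| * (√(level k) ^ a * ‖u k 0‖ ^ 2) := fun k => by
      have h1 := hs1 k
      have h2 : (√(level k) + b) ^ a ≤ (1 + b) ^ |a| * √(level k) ^ a := by
        rw [abs_of_nonneg ha, ← Real.mul_rpow (by positivity) (by positivity)]
        exact Real.rpow_le_rpow (by positivity) (hsb k) ha
      calc _ ≤ (1 + b) ^ |a| * √(level k) ^ a * 1 * ‖u k 0‖ ^ 2 := by
            gcongr
            exact hE k
        _ = _ := by ring
    exact key.trans (Summable.tsum_le_tsum hle
      (Summable.of_nonneg_of_le (fun k => by have := hs1 k; positivity) hle h0') h0')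
  · have key := tsum_moving_weight_le hd (a := a) (β := 0) (γ := b) x hC hode hu hb
      (fun t ht => by
        obtain ⟨t0, t1⟩ := ht
        constructor <;> nlinarith) (by rw [abs_of_nonpos ha]; ring) hε hε1
    simp only [zero_add, add_zero] at key
    have hlow : ∀ k : Fin d → ℕ, √(level k) ^ a ≤ (1 + b) ^ |a| * (√(level k) + b) ^ a :=
      fun k => by
        have h1 := hs1 k
        have h2 : ((1 + b) * √(level k)) ^ a ≤ (√(level k) + b) ^ a :=
          Real.rpow_le_rpow_of_nonpos (by positivity) (hsb k) ha
        rw [Real.mul_rpow (by positivity) (by positivity)] at h2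
        calc √(level k) ^ a = (1 + b) ^ |a| * ((1 + b) ^ a * √(level k) ^ a) := by
              rw [abs_of_nonpos ha, ← mul_assoc, ← Real.rpow_add (by positivity)]
              simp
          _ ≤ _ := by gcongr
    have hup : ∀ k, (√(level k) + b) ^ a ≤ √(level k) ^ a := fun k => by
      have h1 := hs1 k
      exact Real.rpow_le_rpow_of_nonpos (by positivity) (by linarith) ha
    have hsum' : Summable fun k =>
        (√(level k) + b) ^ a * Real.exp (-(ε * (√(level k) + b))) * ‖u k 1‖ ^ 2 := by
      refine Summable.of_nonneg_of_le (fun k => by have := hs1 k; positivity) (fun k => ?_) hsum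
      gcongr ?_ * _ * _
      exact hup k
    have hle : ∀ k, √(level k) ^ a * Real.exp (-(ε * √(level k))) * ‖u k 0‖ ^ 2 ≤
        √(level k) ^ a * ‖u k 0‖ ^ 2 := fun k => by
      calc _ ≤ √(level k) ^ a * 1 * ‖u k 0‖ ^ 2 := by
            gcongr
            exact hE k
        _ = _ := by ring
    calc _ ≤ ∑' k, (1 + b) ^ |a| *
          ((√(level k) + b) ^ a * Real.exp (-(ε * (√(level k) + b))) * ‖u k 1‖ ^ 2) := by
          refine Summable.tsum_le_tsum (fun k => ?_) hsum (hsum'.mul_left _)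
          rw [← mul_assoc, ← mul_assoc]
          gcongr
          exact hlow k
      _ ≤ (1 + b) ^ |a| * ∑' k,
          √(level k) ^ a * Real.exp (-(ε * √(level k))) * ‖u k 0‖ ^ 2 := by
          rw [tsum_mul_left]
          gcongr
      _ ≤ (1 + b) ^ |a| * ∑' k, √(level k) ^ a * ‖u k 0‖ ^ 2 := by
          refine mul_le_mul_of_nonneg_left (Summable.tsum_le_tsum hle ?_ h0) (by positivity)
          exact Summable.of_nonneg_of_le (fun k => by positivity) hle h0
      _ = _ := tsum_mul_left.symm

end Solution

/-! ### Translations on the Hermite–Sobolev spaces -/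

section Translate

variable {𝕜 : Type*} [RCLike 𝕜] {d : ℕ}

theorem hasDerivAt_translate_hermite (φ : TempDist 𝕜 d) (x : EuclideanSpace ℝ (Fin d))
    (k : Fin d → ℕ) (t : ℝ) :
    HasDerivAt (fun t : ℝ => translate (t • x) φ (hermite 𝕜 k))
      (ladderOp x (fun k => translate (t • x) φ (hermite 𝕜 k)) k) t := by
  refine (hasDerivAt_translate φ x (hermite 𝕜 k) t).congr_deriv ?_
  rw [lineDeriv_eq_sum, map_sum, ladderOp]
  refine Finset.sum_congr rfl fun j _ => ?_
  rw [map_smul, lineDeriv_hermite, map_sub, map_smul, map_smul]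
  simp only [RCLike.real_smul_eq_coe_mul, smul_eq_mul]

theorem norm_weightedCoeff_sq (hd : 0 < d) (p : ℝ) (φ : TempDist 𝕜 d) (k : Fin d → ℕ) :
    ‖weightedCoeff p φ k‖ ^ 2 = √(level k) ^ (4 * p) * ‖φ (hermite 𝕜 k)‖ ^ 2 := by
  have h1 := one_le_level hd k
  change ‖((level k ^ p : ℝ) : 𝕜) * φ (hermite 𝕜 k)‖ ^ 2 = _
  rw [norm_mul, mul_pow, RCLike.norm_ofReal, sq_abs, Real.sqrt_eq_rpow,
    ← Real.rpow_mul (by linarith), ← Real.rpow_natCast, ← Real.rpow_mul (by linarith)]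
  congr 2
  push_cast
  ring

theorem memℓp_two_iff {ι : Type*} (f : ι → 𝕜) : Memℓp f 2 ↔ Summable fun i => ‖f i‖ ^ 2 := by
  rw [memℓp_gen_iff (by norm_num)]
  norm_num

theorem sum_translate_le (hd : 0 < d) (p : ℝ) (x : EuclideanSpace ℝ (Fin d)) {φ : TempDist 𝕜 d}
    (hφ : φ ∈ finiteNorm 𝕜 d p) (S : Finset (Fin d → ℕ)) :
    ∑ k ∈ S, ‖weightedCoeff p (translate x φ) k‖ ^ 2 ≤
      (1 + 2 * d * (2 ^ (|4 * p| + 1) * Real.exp 1) * ‖x‖) ^ |4 * p| *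
        ∑' k, ‖weightedCoeff p φ k‖ ^ 2 := by
  obtain ⟨C, M, hC, h⟩ := norm_translate_hermite_le hd φ x
  have e0 : translate ((0 : ℝ) • x) φ = φ := by
    ext f
    simp [translate]
  have h0 := (memℓp_two_iff _).1 hφ
  simp_rw [norm_weightedCoeff_sq hd] at h0 ⊢
  have := sum_weight_le hd (4 * p) x (u := fun k t => translate (t • x) φ (hermite 𝕜 k)) hC
    (hasDerivAt_translate_hermite φ x)
    (fun t ht k => h t (abs_le.2 ⟨by linarith [ht.1], ht.2⟩) k) (by simpa only [e0] using h0) S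
  simpa only [e0, one_smul] using this

theorem translate_mem_finiteNorm (hd : 0 < d) (p : ℝ) (x : EuclideanSpace ℝ (Fin d))
    {φ : TempDist 𝕜 d} (hφ : φ ∈ finiteNorm 𝕜 d p) : translate x φ ∈ finiteNorm 𝕜 d p :=
  (memℓp_two_iff _).2 (summable_of_sum_le (fun _ => sq_nonneg _) (sum_translate_le hd p x hφ))

theorem FiniteNorm.norm_sq_eq_tsum {p : ℝ} (φ : FiniteNorm 𝕜 d p) :
    ‖φ‖ ^ 2 = ∑' k, ‖weightedCoeff p φ.toTempDist k‖ ^ 2 := by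
  have h : ‖φ‖ = ‖FiniteNorm.toL2 φ‖ := rfl
  have h2 := lp.norm_rpow_eq_tsum (p := 2) (by norm_num) (FiniteNorm.toL2 φ)
  norm_num at h2
  rw [h, h2]
  rfl

/-- The translation by `x` on the distributions of finite norm `‖·‖_p`. -/
noncomputable def translateLM (hd : 0 < d) (p : ℝ) (x : EuclideanSpace ℝ (Fin d)) :
    FiniteNorm 𝕜 d p →ₗ[𝕜] FiniteNorm 𝕜 d p where
  toFun φ := ⟨translate x φ.toTempDist, translate_mem_finiteNorm hd p x φ.2⟩
  map_add' _ _ := rfl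
  map_smul' _ _ := rfl

theorem norm_translateLM_le (hd : 0 < d) (p : ℝ) (x : EuclideanSpace ℝ (Fin d))
    (φ : FiniteNorm 𝕜 d p) :
    ‖translateLM hd p x φ‖ ≤
      (1 + 2 * d * (2 ^ (|4 * p| + 1) * Real.exp 1) * ‖x‖) ^ (2 * (⌊|p|⌋₊ + 1)) * ‖φ‖ := by
  set b : ℝ := 2 * d * (2 ^ (|4 * p| + 1) * Real.exp 1) * ‖x‖ with hb
  have hb0 : 0 ≤ b := by positivity
  have h1 : ‖translateLM hd p x φ‖ ^ 2 ≤ (1 + b) ^ |4 * p| * ‖φ‖ ^ 2 := by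
    rw [FiniteNorm.norm_sq_eq_tsum, FiniteNorm.norm_sq_eq_tsum]
    exact Real.tsum_le_of_sum_le (fun _ => sq_nonneg _) (sum_translate_le hd p x φ.2)
  have h2 : (1 + b) ^ |4 * p| ≤ ((1 + b) ^ (2 * (⌊|p|⌋₊ + 1))) ^ 2 := by
    rw [← pow_mul, ← Real.rpow_natCast]
    refine Real.rpow_le_rpow_of_exponent_le (by linarith) ?_
    have := (Nat.lt_floor_add_one |p|).le
    rw [abs_mul, abs_of_pos (by norm_num : (0 : ℝ) < 4)]
    push_cast
    linarith
  refine le_of_sq_le_sq ?_ (by positivity)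
  rw [mul_pow]
  exact h1.trans (by gcongr)

theorem translate_mem_schwartzSubmodule (x : EuclideanSpace ℝ (Fin d)) {φ : TempDist 𝕜 d}
    (hφ : φ ∈ schwartzSubmodule 𝕜 d) : translate x φ ∈ schwartzSubmodule 𝕜 d := by
  obtain ⟨f, hf⟩ := hφ
  refine ⟨SchwartzMap.compSubConstCLM 𝕜 x f, fun g => ?_⟩
  change φ (SchwartzMap.compSubConstCLM 𝕜 (-x) g) = _
  rw [hf, ← integral_sub_right_eq_self (fun y => f y * SchwartzMap.compSubConstCLM 𝕜 (-x) g y) x]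
  simp

/-- The translation by `x` as a bounded operator on the distributions of finite norm. -/
noncomputable def translateCLM (hd : 0 < d) (p : ℝ) (x : EuclideanSpace ℝ (Fin d)) :
    FiniteNorm 𝕜 d p →L[𝕜] FiniteNorm 𝕜 d p :=
  (translateLM hd p x).mkContinuous _ (norm_translateLM_le hd p x)

theorem translateCLM_mem_space (hd : 0 < d) (p : ℝ) (x : EuclideanSpace ℝ (Fin d))
    {φ : FiniteNorm 𝕜 d p} (hφ : φ ∈ Space 𝕜 d p) : translateCLM hd p x φ ∈ Space 𝕜 d p := by
  refine map_mem_closure (translateCLM hd p x).continuous hφ fun ψ hψ => ?_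
  exact translate_mem_schwartzSubmodule x hψ

end Translate

end HermiteSobolev

theorem theorem2p1 (𝕜 : Type*) [RCLike 𝕜] (d : ℕ) (hd : 0 < d) (p : ℝ) :
    ∃ P : Polynomial ℝ, P.natDegree = 2 * (⌊|p|⌋₊ + 1) ∧
      ∀ x : EuclideanSpace ℝ (Fin d),
        ∃ T : HermiteSobolev.Space 𝕜 d p →L[𝕜] HermiteSobolev.Space 𝕜 d p,
          (∀ φ : HermiteSobolev.Space 𝕜 d p,
            HermiteSobolev.Space.toTempDist (T φ) =
              HermiteSobolev.translate x (HermiteSobolev.Space.toTempDist φ)) ∧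
          ∀ φ : HermiteSobolev.Space 𝕜 d p, ‖T φ‖ ≤ P.eval ‖x‖ * ‖φ‖ := by
  set c : ℝ := 2 * d * (2 ^ (|4 * p| + 1) * Real.exp 1) with hc
  have hc0 : c ≠ 0 := by positivity
  refine ⟨(Polynomial.C c * Polynomial.X + Polynomial.C 1) ^ (2 * (⌊|p|⌋₊ + 1)), ?_, fun x => ?_⟩
  · rw [Polynomial.natDegree_pow, Polynomial.natDegree_linear hc0, mul_one]
  · refine ⟨((HermiteSobolev.translateCLM hd p x).comp
      (HermiteSobolev.Space 𝕜 d p).subtypeL).codRestrict (HermiteSobolev.Space 𝕜 d p)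
      fun φ => HermiteSobolev.translateCLM_mem_space hd p x φ.2, fun φ => rfl, fun φ => ?_⟩
    refine (HermiteSobolev.norm_translateLM_le hd p x φ.1).trans (le_of_eq ?_)
    simp only [Polynomial.eval_pow, Polynomial.eval_add, Polynomial.eval_mul, Polynomial.eval_C,
      Polynomial.eval_X]
    rw [add_comm (c * ‖x‖) 1]
    rfl
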